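/- Let $n\ge 2$, let $\mathbb R^n_+=\{x=(x',x_n): x'\in\mathbb R^{n-1},\ x_n>0\}$, and let $\omega_k$ denote the area of the unit sphere in $\mathbb R^k$ (so $\omega_1=2$). For $1\le p<\infty$ let $h^p(\mathbb R^n_+)$ be the space of real harmonic functions $u$ on $\mathbb R^n_+$ that can be represented as a Poisson integral $$u(x)=\frac{2}{\omega_n}\int_{\mathbb R^{n-1}}\frac{x_n}{|y-x|^n}\,f(y')\,dy',\qquad y=(y',0),$$ with boundary values $f\in L^p(\mathbb R^{n-1})$, and put $\|u\|_p=\|f\|_{L^p(\mathbb R^{n-1})}$. For $x\in\mathbb R^n_+$ let $\mathcal C_p(x)$ be the sharp (smallest) coefficient in the inequality $$|\nabla u(x)|\le \mathcal C_p(x)\,\|u\|_p\qquad (u\in h^p(\mathbb R^n_+)).$$ Then for every $1\le p<\infty$ there is a constant $C_p$, depending only on $n$ and $p$, such that $$\mathcal C_p(x)=C_p\,x_n^{(1-n-p)/p}\qquad\text{for all } x\in\mathbb R^n_+ .$$ Moreover, $$C_1=\frac{2(n-1)}{\omega_n},$$ and, if $n\ge 3$ and $1<p<\infty$, $$C_p=\frac{2\,(\omega_{n-2})^{(p-1)/p}}{\omega_n}\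 \sup_{\gamma\ge 0}\ \frac{1}{\sqrt{1+\gamma^2}}\left\{\int_0^{\pi}d\varphi\int_0^{\pi/2}\mathcal F_{n,p}(\varphi,\vartheta;\gamma)\,d\vartheta\right\}^{(p-1)/p},$$ the supremum being finite, where $$\mathcal F_{n,p}(\varphi,\vartheta;\gamma)=\bigl|(n\cos^2\vartheta-1)+n\gamma\cos\vartheta\sin\vartheta\cos\varphi\bigr|^{p/(p-1)}\cos^{n/(p-1)}\vartheta\,\sin^{n-2}\vartheta\,\sin^{n-3}\varphi .$$ In particular (for all $n\ge 2$), $$C_2=\sqrt{\frac{n(n-1)}{2^n\,\omega_n}} .$$ For $p=1$ and $p=2$ the coefficient $\mathcal C_p(x)=C_p\,x_n^{(1-n-p)/p}$ is also the sharp coefficient in the weaker inequality $\left|\partial u/\partial x_n(x)\right|\le \mathcal C_p(x)\,\|u\|_p$, $u\in h^p(\mathbb R^n_+)$. -/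

import Mathlib

noncomputable section

namespace HalfSpaceGradient

open MeasureTheory

/-- `ω_n`: the area (surface measure) of the unit sphere of `ℝⁿ`. -/
def sphereArea (n : ℕ) : ℝ :=
  ((volume : Measure (EuclideanSpace ℝ (Fin n))).toSphere Set.univ).toReal

/-- The open upper half-space of `ℝⁿ`, where `n = d + 1`. -/
def halfSpace (d : ℕ) : Set (EuclideanSpace ℝ (Fin (d + 1))) :=
  {x | 0 < x (Fin.last d)}

/-- The boundary point `(y', 0)` for `y' ∈ ℝⁿ⁻¹`. -/
def bdryPoint {d : ℕ} (y : EuclideanSpace ℝ (Fin d)) : EuclideanSpace ℝ (Fin (d + 1)) :=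
  WithLp.toLp 2 (Fin.snoc (α := fun _ => ℝ) (fun i => y i) 0)

/-- The Poisson integral of `f` over `ℝⁿ⁻¹`, evaluated at `x`, where `n = d + 1`. -/
def poissonIntegral {d : ℕ} (f : EuclideanSpace ℝ (Fin d) → ℝ)
    (x : EuclideanSpace ℝ (Fin (d + 1))) : ℝ :=
  2 / sphereArea (d + 1) *
    ∫ y : EuclideanSpace ℝ (Fin d), x (Fin.last d) / ‖bdryPoint y - x‖ ^ (d + 1) * f y

/-- `u` belongs to the Hardy space `h^p` of the half-space, with boundary values `f`: it is
harmonic in the half-space and is there the Poisson integral of `f ∈ L^p(ℝⁿ⁻¹)`. -/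
structure IsHardyWithBoundary {d : ℕ} (p : ℝ) (u : EuclideanSpace ℝ (Fin (d + 1)) → ℝ)
    (f : EuclideanSpace ℝ (Fin d) → ℝ) : Prop where
  harmonic : InnerProductSpace.HarmonicOnNhd u (halfSpace d)
  memLp : MemLp f (ENNReal.ofReal p) volume
  eq_poisson : ∀ x ∈ halfSpace d, u x = poissonIntegral f x

/-- The admissible coefficients `C` in `|∇u(x)| ≤ C ‖u‖_p`, for all `u ∈ h^p`; `‖u‖_p` is the
`L^p(ℝⁿ⁻¹)` norm of the boundary values of `u`. -/
def gradientCoeffs {d : ℕ} (p : ℝ) (x : EuclideanSpace ℝ (Fin (d + 1))) : Set ℝ :=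
  {C | ∀ u f, IsHardyWithBoundary p u f →
    ‖gradient u x‖ ≤ C * (eLpNorm f (ENNReal.ofReal p) volume).toReal}

/-- The admissible coefficients `C` in `|∂u/∂x_n (x)| ≤ C ‖u‖_p`, for all `u ∈ h^p`. -/
def normalCoeffs {d : ℕ} (p : ℝ) (x : EuclideanSpace ℝ (Fin (d + 1))) : Set ℝ :=
  {C | ∀ u f, IsHardyWithBoundary p u f →
    |lineDeriv ℝ u x (EuclideanSpace.single (Fin.last d) (1 : ℝ))| ≤
      C * (eLpNorm f (ENNReal.ofReal p) volume).toReal}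

/-- The integrand `F_{n,p}(φ, θ; γ)` (used for `n ≥ 3`). -/
def integrand (n : ℕ) (p γ φ θ : ℝ) : ℝ :=
  |((n : ℝ) * Real.cos θ ^ 2 - 1) + n * γ * Real.cos θ * Real.sin θ * Real.cos φ| ^ (p / (p - 1))
    * Real.cos θ ^ ((n : ℝ) / (p - 1)) * Real.sin θ ^ (n - 2) * Real.sin φ ^ (n - 3)

/-- The functional of `γ` whose supremum over `γ ≥ 0` enters the sharp constant. -/
def functional (n : ℕ) (p γ : ℝ) : ℝ :=
  1 / Real.sqrt (1 + γ ^ 2) *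
    (∫ φ in (0 : ℝ)..Real.pi, ∫ θ in (0 : ℝ)..(Real.pi / 2), integrand n p γ φ θ)
      ^ ((p - 1) / p)

end HalfSpaceGradient

end

/-!
The gradient of a Poisson integral `u` of `f ∈ L^p` is the integral of `f` against the gradient of
the Poisson kernel (`hasFDerivAt_poissonIntegral`), and every such `u` is harmonic
(`isHardyWithBoundary_poissonIntegral`): the kernel is the dipole `⟪e, x⟫ ‖x - a‖⁻ⁿ`, whose Hessian
has trace zero, and near any point its derivatives are dominated by a power of the distance to the
pole which lies in every `L^q`. So all `f ∈ L^p` are available as test functions, and by duality the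
best bound for the derivative in a unit direction `z` is the `L^q` norm of the `z`-component of the
kernel's gradient, `q` being the conjugate exponent. Translations and dilations reduce it to the
norm `dirNorm q z` at the point `e_n` of height one, at the price of a power of `x_n`
(`rpow_integral_abs_inner_gradKernel`). The sharp constant is therefore `2 / ω_n` times the supremum
of `dirNorm q z` over unit vectors `z` (`isLeast_gradientCoeffs`).

For `p = 1` the supremum norm of the gradient kernel is attained at the pole below `x`, in the
normal direction (`norm_gradKernel_le_last`, `mem_gradientCoeffs_one_and_mem_lowerBounds`). For
`p = 2` the square of `dirNorm 2 z` is a multiple of `(n - 1) z_n² + |z'|²` (`integral_profile_sq`); the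
factor comes from writing powers of `1 + |t|²` as Gamma integrals of Gaussians. The normal direction
is again extremal. For general `p > 1` and `n ≥ 3`, spherical coordinates about the axis `z'` and
the substitution `r = tan θ` turn `dirNorm q z` into the functional at `γ = |z'| / z_n`
(`dirNorm_eq_functional`); horizontal directions, where `γ = ∞`, are limits of the others.
-/

namespace HalfSpaceGradient

open MeasureTheory Filter Topology InnerProductSpace RealInnerProductSpace Laplacian

/-! ### The dipole kernel and its first two derivatives -/

section Dipole

variable {V : Type*} [NormedAddCommGroup V] [InnerProductSpace ℝ V]

/-- The gradient in `x` of the dipole kernel `⟪e, x⟫ ‖x - a‖⁻ⁿ`. Powers of the distance are written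
as real powers of its square, which is smooth in `x`. -/
noncomputable def dipoleGrad (n : ℝ) (e a x : V) : V :=
  (‖x - a‖ ^ 2) ^ (-n / 2) • e - (n * ⟪e, x⟫ * (‖x - a‖ ^ 2) ^ (-n / 2 - 1)) • (x - a)

/-- The derivative in `x` of `dipoleGrad n e a x`, that is, the Hessian of the dipole kernel. -/
noncomputable def dipoleHess (n : ℝ) (e a x : V) : V →L[ℝ] V :=
  (-n * (‖x - a‖ ^ 2) ^ (-n / 2 - 1)) • ((innerSL ℝ (x - a)).smulRight e
      + (innerSL ℝ e).smulRight (x - a) + ⟪e, x⟫ • ContinuousLinearMap.id ℝ V)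
    + (n * (n + 2) * ⟪e, x⟫ * (‖x - a‖ ^ 2) ^ (-n / 2 - 2)) •
      (innerSL ℝ (x - a)).smulRight (x - a)

lemma hasFDerivAt_normSq_sub_rpow {a x : V} (hx : x ≠ a) (s : ℝ) :
    HasFDerivAt (fun x => (‖x - a‖ ^ 2) ^ s)
      ((2 * s * (‖x - a‖ ^ 2) ^ (s - 1)) • innerSL ℝ (x - a)) x := by
  have h1 : HasFDerivAt (fun x : V => ‖x - a‖ ^ 2) (2 • innerSL ℝ (x - a)) x := by
    simpa using ((hasFDerivAt_id x).sub_const a).norm_sq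
  have hne : ‖x - a‖ ^ 2 ≠ 0 := by simpa [sub_eq_zero] using hx
  convert h1.rpow_const (p := s) (Or.inl hne) using 1
  ext v
  simp
  ring

lemma hasFDerivAt_dipole {e a x : V} (hx : x ≠ a) (n : ℝ) :
    HasFDerivAt (fun x => ⟪e, x⟫ * (‖x - a‖ ^ 2) ^ (-n / 2))
      (innerSL ℝ (dipoleGrad n e a x)) x := by
  have h1 : HasFDerivAt (fun x : V => ⟪e, x⟫) (innerSL ℝ e) x := (innerSL ℝ e).hasFDerivAt
  refine (h1.mul (hasFDerivAt_normSq_sub_rpow hx (-n / 2))).congr_fderiv ?_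
  ext v
  simp [dipoleGrad]
  ring

lemma hasFDerivAt_dipoleGrad {e a x : V} (hx : x ≠ a) (n : ℝ) :
    HasFDerivAt (dipoleGrad n e a) (dipoleHess n e a x) x := by
  have h1 : HasFDerivAt (fun x : V => ⟪e, x⟫) (innerSL ℝ e) x := (innerSL ℝ e).hasFDerivAt
  have h2 := (hasFDerivAt_normSq_sub_rpow hx (-n / 2)).smul_const e
  have h3 := ((h1.const_mul n).mul (hasFDerivAt_normSq_sub_rpow hx (-n / 2 - 1))).smul
    ((hasFDerivAt_id x).sub_const a)
  refine (h2.sub h3).congr_fderiv ?_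
  ext v
  simp [dipoleHess, show -n / 2 - 1 - 1 = -n / 2 - 2 by ring]
  module

lemma abs_inner_le_norm_sub {e a : V} (he : ‖e‖ = 1) (ha : ⟪e, a⟫ = 0) (x : V) :
    |⟪e, x⟫| ≤ ‖x - a‖ := by
  have := abs_real_inner_le_norm e (x - a)
  rwa [inner_sub_right, ha, sub_zero, he, one_mul] at this

lemma normSq_rpow_mul_norm {W : Type*} [NormedAddCommGroup W] {v : W} (hv : v ≠ 0) (s : ℝ) :
    (‖v‖ ^ 2) ^ s * ‖v‖ = (‖v‖ ^ 2) ^ (s + 1 / 2) := by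
  have h : 0 < ‖v‖ := norm_pos_iff.2 hv
  rw [Real.rpow_add (by positivity), ← Real.sqrt_eq_rpow, Real.sqrt_sq h.le]

lemma norm_dipoleGrad_le {n : ℝ} (hn : 0 ≤ n) {e a x : V} (he : ‖e‖ = 1) (ha : ⟪e, a⟫ = 0)
    (hx : x ≠ a) : ‖dipoleGrad n e a x‖ ≤ (1 + n) * (‖x - a‖ ^ 2) ^ (-n / 2) := by
  have hv : x - a ≠ 0 := sub_ne_zero.2 hx
  have h := abs_inner_le_norm_sub he ha x
  have h2 : (‖x - a‖ ^ 2) ^ (-n / 2 - 1) * ‖x - a‖ * ‖x - a‖ = (‖x - a‖ ^ 2) ^ (-n / 2) := by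
    rw [normSq_rpow_mul_norm hv, normSq_rpow_mul_norm hv]; congr 1; ring
  refine (norm_sub_le _ _).trans ?_
  rw [norm_smul, norm_smul, he, Real.norm_eq_abs, Real.norm_eq_abs, abs_mul, abs_mul,
    abs_of_nonneg hn, abs_of_nonneg (by positivity : (0:ℝ) ≤ (‖x - a‖ ^ 2) ^ (-n / 2)),
    abs_of_nonneg (by positivity : (0:ℝ) ≤ (‖x - a‖ ^ 2) ^ (-n / 2 - 1))]
  calc _ ≤ (‖x - a‖ ^ 2) ^ (-n / 2) * 1
        + n * ‖x - a‖ * (‖x - a‖ ^ 2) ^ (-n / 2 - 1) * ‖x - a‖ := by gcongr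
    _ = (‖x - a‖ ^ 2) ^ (-n / 2)
        + n * ((‖x - a‖ ^ 2) ^ (-n / 2 - 1) * ‖x - a‖ * ‖x - a‖) := by ring
    _ = _ := by rw [h2]; ring

lemma norm_dipoleHess_le {n : ℝ} (hn : 0 ≤ n) {e a x : V} (he : ‖e‖ = 1) (ha : ⟪e, a⟫ = 0)
    (hx : x ≠ a) :
    ‖dipoleHess n e a x‖ ≤ (n * (n + 5)) * (‖x - a‖ ^ 2) ^ (-(n + 1) / 2) := by
  have hv : x - a ≠ 0 := sub_ne_zero.2 hx
  have h := abs_inner_le_norm_sub he ha x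
  have h2 : (‖x - a‖ ^ 2) ^ (-n / 2 - 1) * ‖x - a‖ = (‖x - a‖ ^ 2) ^ (-(n + 1) / 2) := by
    rw [normSq_rpow_mul_norm hv]; congr 1; ring
  have h3 : (‖x - a‖ ^ 2) ^ (-n / 2 - 2) * ‖x - a‖ * ‖x - a‖ * ‖x - a‖
      = (‖x - a‖ ^ 2) ^ (-(n + 1) / 2) := by
    rw [normSq_rpow_mul_norm hv, normSq_rpow_mul_norm hv, normSq_rpow_mul_norm hv]
    congr 1; ring
  have hid : ‖ContinuousLinearMap.id ℝ V‖ ≤ 1 := ContinuousLinearMap.norm_id_le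
  have h4 : ‖(innerSL ℝ (x - a)).smulRight e + (innerSL ℝ e).smulRight (x - a)
      + ⟪e, x⟫ • ContinuousLinearMap.id ℝ V‖ ≤ 3 * ‖x - a‖ := by
    refine (norm_add₃_le).trans ?_
    rw [norm_smul, ContinuousLinearMap.norm_smulRight_apply,
      ContinuousLinearMap.norm_smulRight_apply, innerSL_apply_norm, innerSL_apply_norm, he,
      Real.norm_eq_abs]
    have : |⟪e, x⟫| * ‖ContinuousLinearMap.id ℝ V‖ ≤ ‖x - a‖ * 1 := by gcongr
    linarith
  refine (norm_add_le _ _).trans ?_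
  rw [norm_smul, norm_smul, ContinuousLinearMap.norm_smulRight_apply, innerSL_apply_norm,
    Real.norm_eq_abs, Real.norm_eq_abs, abs_mul, abs_mul, abs_mul, abs_neg,
    abs_of_nonneg hn, abs_of_nonneg (by positivity : (0:ℝ) ≤ n * (n + 2)),
    abs_of_nonneg (by positivity : (0:ℝ) ≤ (‖x - a‖ ^ 2) ^ (-n / 2 - 2)),
    abs_of_nonneg (by positivity : (0:ℝ) ≤ (‖x - a‖ ^ 2) ^ (-n / 2 - 1))]
  calc _ ≤ n * (‖x - a‖ ^ 2) ^ (-n / 2 - 1) * (3 * ‖x - a‖)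
        + n * (n + 2) * ‖x - a‖ * (‖x - a‖ ^ 2) ^ (-n / 2 - 2) * (‖x - a‖ * ‖x - a‖) := by
        gcongr
    _ = 3 * n * ((‖x - a‖ ^ 2) ^ (-n / 2 - 1) * ‖x - a‖)
        + n * (n + 2) * ((‖x - a‖ ^ 2) ^ (-n / 2 - 2) * ‖x - a‖ * ‖x - a‖ * ‖x - a‖) := by ring
    _ = _ := by rw [h2, h3]; ring

/-- The dipole kernel is harmonic: the trace of its Hessian vanishes when the exponent is the
dimension of the space. -/
lemma sum_inner_dipoleHess {ι : Type*} [Fintype ι] (b : OrthonormalBasis ι ℝ V) {e a x : V}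
    (ha : ⟪e, a⟫ = 0) (hx : x ≠ a) :
    ∑ i, ⟪dipoleHess (Fintype.card ι) e a x (b i), b i⟫ = 0 := by
  set n : ℝ := (Fintype.card ι : ℝ) with hn
  have h1 : ∑ i, ⟪x - a, b i⟫ * ⟪e, b i⟫ = ⟪e, x⟫ := by
    have := b.sum_inner_mul_inner (x - a) e
    simp_rw [real_inner_comm e] at this ⊢
    rw [this, inner_sub_right, ha, sub_zero]
  have h2 : ∑ i, ⟪x - a, b i⟫ * ⟪x - a, b i⟫ = ‖x - a‖ ^ 2 := by
    simpa [pow_two] using b.sum_sq_inner_left (x - a)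
  have h3 : (‖x - a‖ ^ 2) ^ (-n / 2 - 1) = (‖x - a‖ ^ 2) ^ (-n / 2 - 2) * ‖x - a‖ ^ 2 := by
    have : 0 < ‖x - a‖ := norm_pos_iff.2 (sub_ne_zero.2 hx)
    rw [← Real.rpow_add_one (by positivity)]; congr 1; ring
  have key : ∀ i, ⟪dipoleHess n e a x (b i), b i⟫
      = (-n * (‖x - a‖ ^ 2) ^ (-n / 2 - 1)) * (2 * (⟪x - a, b i⟫ * ⟪e, b i⟫) + ⟪e, x⟫)
      + (n * (n + 2) * ⟪e, x⟫ * (‖x - a‖ ^ 2) ^ (-n / 2 - 2)) *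
        (⟪x - a, b i⟫ * ⟪x - a, b i⟫) := by
    intro i
    simp only [dipoleHess, add_apply, smul_apply,
      ContinuousLinearMap.smulRight_apply, innerSL_apply_apply, ContinuousLinearMap.id_apply,
      inner_add_left, inner_smul_left, real_inner_self_eq_norm_sq, b.norm_eq_one,
      conj_trivial]
    ring
  rw [Finset.sum_congr rfl fun i _ => key i, Finset.sum_add_distrib, ← Finset.mul_sum,
    ← Finset.mul_sum, Finset.sum_add_distrib, ← Finset.mul_sum, h1, h2, h3, Finset.sum_const,
    Finset.card_univ, nsmul_eq_mul, ← hn]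
  ring

lemma continuousAt_dipoleHess {e a x : V} (hx : x ≠ a) (n : ℝ) :
    ContinuousAt (dipoleHess n e a) x := by
  have hne : ‖x - a‖ ^ 2 ≠ 0 := by simpa [sub_eq_zero] using hx
  have hp : ∀ s : ℝ, ContinuousAt (fun x => (‖x - a‖ ^ 2) ^ s) x := fun s =>
    (hasFDerivAt_normSq_sub_rpow hx s).continuousAt
  have hs : ∀ {f g : V → V}, ContinuousAt f x → ContinuousAt g x →
      ContinuousAt (fun x => (innerSL ℝ (f x)).smulRight (g x)) x := by
    intro f g hf hg
    exact ((ContinuousLinearMap.smulRightL ℝ V V).isBoundedBilinearMap.continuous.continuousAt).comp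
      (((innerSL ℝ).continuous.continuousAt.comp hf).prodMk hg)
  have hc : ContinuousAt (fun x : V => x - a) x := by fun_prop
  have hi : ContinuousAt (fun x : V => ⟪e, x⟫) x := by fun_prop
  unfold dipoleHess
  refine ContinuousAt.add (ContinuousAt.smul (continuousAt_const.mul (hp _))
    (((hs hc continuousAt_const).add (hs continuousAt_const hc)).add
      (hi.smul continuousAt_const)))
    (((continuousAt_const.mul hi).mul (hp _)).smul (hs hc hc))

end Dipole

/-! ### The half-space and integrability of powers of the distance to its boundary -/

section Geometry

variable {d : ℕ}

/-- The unit vector `e_n`, normal to the boundary of the half-space. -/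
noncomputable def normalVec (d : ℕ) : EuclideanSpace ℝ (Fin (d + 1)) :=
  EuclideanSpace.single (Fin.last d) (1 : ℝ)

/-- The horizontal part `x'` of `x = (x', x_n)`. -/
def horiz (x : EuclideanSpace ℝ (Fin (d + 1))) : EuclideanSpace ℝ (Fin d) :=
  WithLp.toLp 2 fun i => x i.castSucc

lemma norm_normalVec : ‖normalVec d‖ = 1 := by simp [normalVec]

lemma inner_normalVec (x : EuclideanSpace ℝ (Fin (d + 1))) :
    ⟪normalVec d, x⟫ = x (Fin.last d) := by
  simp [normalVec, EuclideanSpace.inner_single_left]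

lemma bdryPoint_last (y : EuclideanSpace ℝ (Fin d)) : bdryPoint y (Fin.last d) = 0 := by
  simp [bdryPoint]

lemma bdryPoint_castSucc (y : EuclideanSpace ℝ (Fin d)) (i : Fin d) :
    bdryPoint y i.castSucc = y i := by
  simp [bdryPoint]

lemma inner_normalVec_bdryPoint (y : EuclideanSpace ℝ (Fin d)) :
    ⟪normalVec d, bdryPoint y⟫ = 0 := by
  rw [inner_normalVec, bdryPoint_last]

lemma norm_sq_eq_horiz (x : EuclideanSpace ℝ (Fin (d + 1))) :
    ‖x‖ ^ 2 = ‖horiz x‖ ^ 2 + x (Fin.last d) ^ 2 := by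
  simp [EuclideanSpace.norm_sq_eq, Fin.sum_univ_castSucc, horiz]

lemma horiz_sub_bdryPoint (x : EuclideanSpace ℝ (Fin (d + 1))) (y : EuclideanSpace ℝ (Fin d)) :
    horiz (x - bdryPoint y) = horiz x - y := by
  ext i
  simp [horiz, bdryPoint_castSucc]

lemma norm_sq_sub_bdryPoint (x : EuclideanSpace ℝ (Fin (d + 1))) (y : EuclideanSpace ℝ (Fin d)) :
    ‖x - bdryPoint y‖ ^ 2 = ‖horiz x - y‖ ^ 2 + x (Fin.last d) ^ 2 := by
  rw [norm_sq_eq_horiz, horiz_sub_bdryPoint]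
  simp [bdryPoint_last]

lemma ne_bdryPoint {x : EuclideanSpace ℝ (Fin (d + 1))} (hx : x ∈ halfSpace d)
    (y : EuclideanSpace ℝ (Fin d)) : x ≠ bdryPoint y := by
  rintro rfl
  have : 0 < bdryPoint y (Fin.last d) := hx
  rw [bdryPoint_last] at this
  exact this.false

lemma normSq_sub_bdryPoint_pos {x : EuclideanSpace ℝ (Fin (d + 1))} (hx : x ∈ halfSpace d)
    (y : EuclideanSpace ℝ (Fin d)) : 0 < ‖x - bdryPoint y‖ ^ 2 := by
  have := norm_pos_iff.2 (sub_ne_zero.2 (ne_bdryPoint hx y))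
  positivity

lemma last_le_norm_sub_bdryPoint (x : EuclideanSpace ℝ (Fin (d + 1)))
    (y : EuclideanSpace ℝ (Fin d)) : x (Fin.last d) ≤ ‖x - bdryPoint y‖ := by
  have := abs_inner_le_norm_sub norm_normalVec (inner_normalVec_bdryPoint y) x
  rw [inner_normalVec] at this
  exact (le_abs_self _).trans this

lemma continuous_bdryPoint :
    Continuous (bdryPoint : EuclideanSpace ℝ (Fin d) → EuclideanSpace ℝ (Fin (d + 1))) := by
  refine (PiLp.continuous_toLp 2 _).comp (continuous_pi fun i => ?_)
  induction i using Fin.lastCases with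
  | last => simpa using continuous_const
  | cast i => simp only [Fin.snoc_castSucc]; fun_prop

lemma isOpen_halfSpace : IsOpen (halfSpace d) :=
  isOpen_lt continuous_const (by fun_prop)

lemma continuous_normSq_rpow {x : EuclideanSpace ℝ (Fin (d + 1))} (hx : x ∈ halfSpace d) (s : ℝ) :
    Continuous fun y : EuclideanSpace ℝ (Fin d) => (‖x - bdryPoint y‖ ^ 2) ^ s :=
  ((continuous_const.sub continuous_bdryPoint).norm.pow 2).rpow_const
    fun y => Or.inl (normSq_sub_bdryPoint_pos hx y).ne'

lemma integrable_normSq_rpow {x : EuclideanSpace ℝ (Fin (d + 1))} (hx : x ∈ halfSpace d) {r : ℝ}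
    (hr : d < r) :
    Integrable fun y : EuclideanSpace ℝ (Fin d) => (‖x - bdryPoint y‖ ^ 2) ^ (-r / 2) := by
  have hx' : 0 < x (Fin.last d) := hx
  have h1 := integrable_rpow_neg_one_add_norm_sq (E := EuclideanSpace ℝ (Fin d)) (r := r)
    (μ := volume) (by simpa using hr)
  have h2 := ((h1.comp_smul (inv_ne_zero hx'.ne')).comp_sub_right (horiz x)).const_mul
    ((x (Fin.last d) ^ 2) ^ (-r / 2))
  refine h2.congr (ae_of_all _ fun y => ?_)
  simp only
  rw [← Real.mul_rpow (by positivity) (by positivity), norm_sq_sub_bdryPoint, norm_smul,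
    norm_sub_rev, mul_pow, norm_inv, Real.norm_of_nonneg hx'.le]
  congr 1
  field_simp
  ring

lemma memLp_normSq_rpow {x : EuclideanSpace ℝ (Fin (d + 1))} (hx : x ∈ halfSpace d) {r : ℝ}
    (hr : d < r) {q : ENNReal} (hq : 1 ≤ q) :
    MemLp (fun y : EuclideanSpace ℝ (Fin d) => (‖x - bdryPoint y‖ ^ 2) ^ (-r / 2)) q := by
  have hx' : 0 < x (Fin.last d) := hx
  have hr0 : 0 ≤ r := (Nat.cast_nonneg d).trans hr.le
  have hm := (continuous_normSq_rpow hx (-r / 2)).aestronglyMeasurable (μ := volume)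
  by_cases hqt : q = ⊤
  · subst hqt
    refine memLp_top_of_bound hm ((x (Fin.last d) ^ 2) ^ (-r / 2)) (ae_of_all _ fun y => ?_)
    rw [Real.norm_of_nonneg (by positivity)]
    refine Real.rpow_le_rpow_of_nonpos (by positivity) ?_ (by linarith)
    rw [norm_sq_sub_bdryPoint]
    exact le_add_of_nonneg_left (sq_nonneg _)
  · have hq0 : q ≠ 0 := (zero_lt_one.trans_le hq).ne'
    have hq1 : 1 ≤ q.toReal := by
      simpa using (ENNReal.toReal_le_toReal ENNReal.one_ne_top hqt).2 hq
    rw [← integrable_norm_rpow_iff hm hq0 hqt]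
    refine (integrable_normSq_rpow hx (r := r * q.toReal) (by nlinarith)).congr
      (ae_of_all _ fun y => ?_)
    simp only
    rw [Real.norm_of_nonneg (by positivity), ← Real.rpow_mul (by positivity)]
    congr 1
    ring

lemma integrable_normSq_rpow_mul {x : EuclideanSpace ℝ (Fin (d + 1))} (hx : x ∈ halfSpace d)
    {r : ℝ} (hr : d < r) {p : ENNReal} (hp : 1 ≤ p) {f : EuclideanSpace ℝ (Fin d) → ℝ}
    (hf : MemLp f p) :
    Integrable fun y : EuclideanSpace ℝ (Fin d) => (‖x - bdryPoint y‖ ^ 2) ^ (-r / 2) * f y := by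
  have hc : p.HolderConjugate p.conjExponent := .conjExponent hp
  have hc' : p.conjExponent.HolderConjugate p := hc.symm
  exact (memLp_normSq_rpow hx hr hc'.one_le).integrable_mul hf

lemma mem_halfSpace_of_mem_ball {x x₀ : EuclideanSpace ℝ (Fin (d + 1))}
    (hx : x ∈ Metric.ball x₀ (x₀ (Fin.last d) / 2)) : x ∈ halfSpace d := by
  rw [mem_ball_iff_norm] at hx
  have h1 : |(x - x₀) (Fin.last d)| ≤ ‖x - x₀‖ := by
    rw [← Real.norm_eq_abs]; exact PiLp.norm_apply_le _ _
  have h2 := (abs_le.1 (h1.trans hx.le)).1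
  have h3 : 0 < x₀ (Fin.last d) := by
    have := (norm_nonneg _).trans_lt hx
    linarith
  show 0 < x (Fin.last d)
  simp only [PiLp.sub_apply] at h2
  have h4 := hx.trans_le' h1
  simp only [PiLp.sub_apply] at h4
  have := (abs_lt.1 h4).1
  linarith

/-- On the ball of radius `x₀ₙ / 2` about `x₀`, distances to boundary points are comparable to
those from `x₀`, which gives a locally uniform dominating function. -/
lemma normSq_rpow_le_of_mem_ball {x x₀ : EuclideanSpace ℝ (Fin (d + 1))}
    (hx : x ∈ Metric.ball x₀ (x₀ (Fin.last d) / 2)) (y : EuclideanSpace ℝ (Fin d)) {r : ℝ}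
    (hr : 0 ≤ r) (hx₀ : x₀ ∈ halfSpace d) :
    (‖x - bdryPoint y‖ ^ 2) ^ (-r / 2) ≤
      (1 / 4 : ℝ) ^ (-r / 2) * (‖x₀ - bdryPoint y‖ ^ 2) ^ (-r / 2) := by
  have hS := normSq_sub_bdryPoint_pos hx₀ y
  rw [← Real.mul_rpow (by positivity) (by positivity)]
  refine Real.rpow_le_rpow_of_nonpos (by positivity) ?_ (by linarith)
  rw [mem_ball_iff_norm] at hx
  have h1 := last_le_norm_sub_bdryPoint x₀ y
  have h2 : ‖x₀ - bdryPoint y‖ ≤ ‖x - bdryPoint y‖ + ‖x - x₀‖ := by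
    rw [norm_sub_rev x x₀]
    calc _ = ‖(x - bdryPoint y) + (x₀ - x)‖ := by congr 1; abel
      _ ≤ _ := norm_add_le _ _
  have h3 : ‖x₀ - bdryPoint y‖ / 2 ≤ ‖x - bdryPoint y‖ := by linarith
  calc _ = (‖x₀ - bdryPoint y‖ / 2) ^ 2 := by ring
    _ ≤ _ := by gcongr

end Geometry

/-! ### Differentiating the Poisson integral -/

section Poisson

variable {d : ℕ}

/-- The gradient in `x` of the Poisson kernel with pole `(y, 0)`, up to the factor `2 / ω_n`. -/
noncomputable def gradKernel (x : EuclideanSpace ℝ (Fin (d + 1))) (y : EuclideanSpace ℝ (Fin d)) :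
    EuclideanSpace ℝ (Fin (d + 1)) :=
  dipoleGrad ((d + 1 : ℕ) : ℝ) (normalVec d) (bdryPoint y) x

/-- The Hessian in `x` of the Poisson kernel with pole `(y, 0)`, up to the factor `2 / ω_n`. -/
noncomputable def hessKernel (x : EuclideanSpace ℝ (Fin (d + 1))) (y : EuclideanSpace ℝ (Fin d)) :
    EuclideanSpace ℝ (Fin (d + 1)) →L[ℝ] EuclideanSpace ℝ (Fin (d + 1)) :=
  dipoleHess ((d + 1 : ℕ) : ℝ) (normalVec d) (bdryPoint y) x

/-- The integral against `f` of the gradient of the Poisson kernel, up to the factor `2 / ω_n`. -/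
noncomputable def gradIntegral (f : EuclideanSpace ℝ (Fin d) → ℝ)
    (x : EuclideanSpace ℝ (Fin (d + 1))) : EuclideanSpace ℝ (Fin (d + 1)) :=
  ∫ y, f y • gradKernel x y

lemma poissonIntegral_eq_integral_dipole (f : EuclideanSpace ℝ (Fin d) → ℝ)
    (x : EuclideanSpace ℝ (Fin (d + 1))) :
    poissonIntegral f x = 2 / sphereArea (d + 1) * ∫ y,
      f y * (⟪normalVec d, x⟫ * (‖x - bdryPoint y‖ ^ 2) ^ (-((d + 1 : ℕ) : ℝ) / 2)) := by
  unfold poissonIntegral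
  congr 2
  ext y
  rw [inner_normalVec, mul_comm, norm_sub_rev, neg_div, Real.rpow_neg (by positivity),
    ← Real.rpow_natCast _ 2, ← Real.rpow_mul (norm_nonneg _), ← Real.rpow_natCast _ (d + 1),
    div_eq_mul_inv]
  congr 5
  push_cast
  ring

lemma continuous_gradKernel {x : EuclideanSpace ℝ (Fin (d + 1))} (hx : x ∈ halfSpace d) :
    Continuous (gradKernel x) :=
  ((continuous_normSq_rpow hx _).smul continuous_const).sub
    ((continuous_const.mul (continuous_normSq_rpow hx _)).smul
      (continuous_const.sub continuous_bdryPoint))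

lemma continuous_hessKernel {x : EuclideanSpace ℝ (Fin (d + 1))} (hx : x ∈ halfSpace d) :
    Continuous (hessKernel x) := by
  have hs : ∀ {f g : EuclideanSpace ℝ (Fin d) → EuclideanSpace ℝ (Fin (d + 1))}, Continuous f →
      Continuous g → Continuous (fun y => (innerSL ℝ (f y)).smulRight (g y)) := by
    intro f g hf hg
    exact (ContinuousLinearMap.smulRightL ℝ (EuclideanSpace ℝ (Fin (d + 1)))
      (EuclideanSpace ℝ (Fin (d + 1)))).isBoundedBilinearMap.continuous.comp
      (((innerSL ℝ).continuous.comp hf).prodMk hg)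
  have hc : Continuous fun y : EuclideanSpace ℝ (Fin d) => x - bdryPoint y :=
    continuous_const.sub continuous_bdryPoint
  exact ((continuous_const.mul (continuous_normSq_rpow hx _)).smul
    (((hs hc continuous_const).add (hs continuous_const hc)).add continuous_const)).add
    ((continuous_const.mul (continuous_normSq_rpow hx _)).smul (hs hc hc))

lemma norm_gradKernel_le {x : EuclideanSpace ℝ (Fin (d + 1))} (hx : x ∈ halfSpace d)
    (y : EuclideanSpace ℝ (Fin d)) :
    ‖gradKernel x y‖ ≤ (1 + ((d + 1 : ℕ) : ℝ)) *
      (‖x - bdryPoint y‖ ^ 2) ^ (-((d + 1 : ℕ) : ℝ) / 2) :=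
  norm_dipoleGrad_le (Nat.cast_nonneg _) norm_normalVec (inner_normalVec_bdryPoint y)
    (ne_bdryPoint hx y)

lemma norm_hessKernel_le {x : EuclideanSpace ℝ (Fin (d + 1))} (hx : x ∈ halfSpace d)
    (y : EuclideanSpace ℝ (Fin d)) :
    ‖hessKernel x y‖ ≤ (((d + 1 : ℕ) : ℝ) * (((d + 1 : ℕ) : ℝ) + 5)) *
      (‖x - bdryPoint y‖ ^ 2) ^ (-(((d + 1 : ℕ) : ℝ) + 1) / 2) :=
  norm_dipoleHess_le (Nat.cast_nonneg _) norm_normalVec (inner_normalVec_bdryPoint y)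
    (ne_bdryPoint hx y)

lemma memLp_gradKernel {x : EuclideanSpace ℝ (Fin (d + 1))} (hx : x ∈ halfSpace d) {q : ENNReal}
    (hq : 1 ≤ q) : MemLp (gradKernel x) q := by
  have h := (memLp_normSq_rpow hx (r := ((d + 1 : ℕ) : ℝ)) (by push_cast; linarith) hq).const_mul
    (1 + ((d + 1 : ℕ) : ℝ))
  refine h.mono (continuous_gradKernel hx).aestronglyMeasurable (ae_of_all _ fun y => ?_)
  exact (norm_gradKernel_le hx y).trans (le_abs_self _)

variable {p : ENNReal} {f : EuclideanSpace ℝ (Fin d) → ℝ}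

lemma integrable_smul_gradKernel {x : EuclideanSpace ℝ (Fin (d + 1))} (hx : x ∈ halfSpace d)
    (hp : 1 ≤ p) (hf : MemLp f p) : Integrable fun y => f y • gradKernel x y := by
  have h := (integrable_normSq_rpow_mul hx (r := ((d + 1 : ℕ) : ℝ)) (by push_cast; linarith)
    hp hf).norm.const_mul (1 + ((d + 1 : ℕ) : ℝ))
  refine h.mono' (hf.1.smul (continuous_gradKernel hx).aestronglyMeasurable)
    (ae_of_all _ fun y => ?_)
  rw [norm_smul, norm_mul, Real.norm_of_nonneg (by positivity :
    0 ≤ (‖x - bdryPoint y‖ ^ 2) ^ (-((d + 1 : ℕ) : ℝ) / 2)), ← mul_assoc, mul_comm]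
  gcongr
  exact norm_gradKernel_le hx y

lemma hasFDerivAt_poissonIntegral {x : EuclideanSpace ℝ (Fin (d + 1))} (hx : x ∈ halfSpace d)
    (hp : 1 ≤ p) (hf : MemLp f p) :
    HasFDerivAt (poissonIntegral f)
      (innerSL ℝ ((2 / sphereArea (d + 1)) • gradIntegral f x)) x := by
  have hx' : 0 < x (Fin.last d) := hx
  set n : ℝ := ((d + 1 : ℕ) : ℝ) with hn
  have hdn : (d : ℝ) < n := by rw [hn]; push_cast; linarith
  have hcont : ∀ x ∈ halfSpace d, Continuous fun y : EuclideanSpace ℝ (Fin d) =>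
      ⟪normalVec d, x⟫ * (‖x - bdryPoint y‖ ^ 2) ^ (-n / 2) := fun x hx =>
    continuous_const.mul (continuous_normSq_rpow hx _)
  have hint := integrable_normSq_rpow_mul hx hdn hp hf
  have key := hasFDerivAt_integral_of_dominated_of_fderiv_le (𝕜 := ℝ) (μ := volume)
    (s := Metric.ball x (x (Fin.last d) / 2))
    (F := fun x y => f y * (⟪normalVec d, x⟫ * (‖x - bdryPoint y‖ ^ 2) ^ (-n / 2)))
    (F' := fun x y => f y • innerSL ℝ (gradKernel x y)) (x₀ := x)
    (bound := fun y => ((1 + n) * (1 / 4 : ℝ) ^ (-n / 2)) *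
      ‖(‖x - bdryPoint y‖ ^ 2) ^ (-n / 2) * f y‖)
    (Metric.ball_mem_nhds _ (by positivity)) ?_ ?_ ?_ ?_ (hint.norm.const_mul _) ?_
  · have hfun : poissonIntegral f = fun x => 2 / sphereArea (d + 1) * ∫ y,
      f y * (⟪normalVec d, x⟫ * (‖x - bdryPoint y‖ ^ 2) ^ (-n / 2)) :=
      funext fun x => poissonIntegral_eq_integral_dipole f x
    rw [hfun]
    refine (key.const_mul (2 / sphereArea (d + 1))).congr_fderiv ?_
    rw [map_smul]
    congr 1
    have := (innerSL ℝ (E := EuclideanSpace ℝ (Fin (d + 1)))).integral_comp_comm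
      (integrable_smul_gradKernel hx hp hf)
    rw [gradIntegral, ← this]
    simp
  · filter_upwards [isOpen_halfSpace.mem_nhds hx] with x hx
    exact hf.1.mul (hcont x hx).aestronglyMeasurable
  · refine (hint.const_mul ⟪normalVec d, x⟫).congr (ae_of_all _ fun y => ?_)
    simp only
    ring
  · exact hf.1.smul ((innerSL ℝ).continuous.comp
      (continuous_gradKernel hx)).aestronglyMeasurable
  · refine ae_of_all _ fun y x' hx' => ?_
    rw [norm_smul, innerSL_apply_norm, norm_mul, Real.norm_of_nonneg (by positivity :
      0 ≤ (‖x - bdryPoint y‖ ^ 2) ^ (-n / 2)), ← mul_assoc, mul_comm]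
    gcongr
    refine (norm_gradKernel_le (mem_halfSpace_of_mem_ball hx') y).trans ?_
    rw [mul_assoc]
    gcongr
    exact normSq_rpow_le_of_mem_ball hx' y (Nat.cast_nonneg _) hx
  · refine ae_of_all _ fun y x' hx' => ?_
    exact ((hasFDerivAt_dipole (ne_bdryPoint (mem_halfSpace_of_mem_ball hx') y) n).const_mul (f y))

/-- The dominating function for the Hessian kernel near `x`. -/
lemma norm_smul_hessKernel_le_of_mem_ball {x x' : EuclideanSpace ℝ (Fin (d + 1))}
    (hx : x ∈ halfSpace d) (hx' : x' ∈ Metric.ball x (x (Fin.last d) / 2))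
    (y : EuclideanSpace ℝ (Fin d)) :
    ‖f y • hessKernel x' y‖ ≤ ((((d + 1 : ℕ) : ℝ) * (((d + 1 : ℕ) : ℝ) + 5)) *
      (1 / 4 : ℝ) ^ (-(((d + 1 : ℕ) : ℝ) + 1) / 2)) *
      ‖(‖x - bdryPoint y‖ ^ 2) ^ (-(((d + 1 : ℕ) : ℝ) + 1) / 2) * f y‖ := by
  rw [norm_smul, norm_mul, Real.norm_of_nonneg (by positivity :
    0 ≤ (‖x - bdryPoint y‖ ^ 2) ^ (-(((d + 1 : ℕ) : ℝ) + 1) / 2)), ← mul_assoc, mul_comm]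
  gcongr
  refine (norm_hessKernel_le (mem_halfSpace_of_mem_ball hx') y).trans ?_
  refine (mul_le_mul_of_nonneg_left (normSq_rpow_le_of_mem_ball hx' y ?_ hx) ?_).trans_eq
    (mul_assoc _ _ _).symm <;> positivity

lemma integrable_hessKernel_bound {x : EuclideanSpace ℝ (Fin (d + 1))} (hx : x ∈ halfSpace d)
    (hp : 1 ≤ p) (hf : MemLp f p) : Integrable fun y : EuclideanSpace ℝ (Fin d) =>
      ((((d + 1 : ℕ) : ℝ) * (((d + 1 : ℕ) : ℝ) + 5)) *
      (1 / 4 : ℝ) ^ (-(((d + 1 : ℕ) : ℝ) + 1) / 2)) *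
      ‖(‖x - bdryPoint y‖ ^ 2) ^ (-(((d + 1 : ℕ) : ℝ) + 1) / 2) * f y‖ :=
  (integrable_normSq_rpow_mul hx (by push_cast; linarith) hp hf).norm.const_mul _

lemma integrable_smul_hessKernel {x : EuclideanSpace ℝ (Fin (d + 1))} (hx : x ∈ halfSpace d)
    (hp : 1 ≤ p) (hf : MemLp f p) : Integrable fun y => f y • hessKernel x y :=
  (integrable_hessKernel_bound hx hp hf).mono'
    (hf.1.smul (continuous_hessKernel hx).aestronglyMeasurable)
    (ae_of_all _ fun y => norm_smul_hessKernel_le_of_mem_ball hx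
      (Metric.mem_ball_self (half_pos hx)) y)

lemma hasFDerivAt_gradIntegral {x : EuclideanSpace ℝ (Fin (d + 1))} (hx : x ∈ halfSpace d)
    (hp : 1 ≤ p) (hf : MemLp f p) :
    HasFDerivAt (gradIntegral f) (∫ y, f y • hessKernel x y) x := by
  refine hasFDerivAt_integral_of_dominated_of_fderiv_le (𝕜 := ℝ) (μ := volume)
    (F' := fun x y => f y • hessKernel x y)
    (Metric.ball_mem_nhds x (half_pos hx)) ?_ (integrable_smul_gradKernel hx hp hf)
    (hf.1.smul (continuous_hessKernel hx).aestronglyMeasurable)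
    (ae_of_all _ fun y x' hx' => norm_smul_hessKernel_le_of_mem_ball hx hx' y)
    (integrable_hessKernel_bound hx hp hf) ?_
  · filter_upwards [isOpen_halfSpace.mem_nhds hx] with x hx
    exact hf.1.smul (continuous_gradKernel hx).aestronglyMeasurable
  · refine ae_of_all _ fun y x' hx' => ?_
    exact (hasFDerivAt_dipoleGrad
      (ne_bdryPoint (mem_halfSpace_of_mem_ball hx') y) _).const_smul (f y)

lemma continuousAt_integral_hessKernel {x : EuclideanSpace ℝ (Fin (d + 1))}
    (hx : x ∈ halfSpace d) (hp : 1 ≤ p) (hf : MemLp f p) :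
    ContinuousAt (fun x => ∫ y, f y • hessKernel x y) x := by
  refine continuousAt_of_dominated ?_ ?_ (integrable_hessKernel_bound hx hp hf) ?_
  · filter_upwards [isOpen_halfSpace.mem_nhds hx] with x hx
    exact hf.1.smul (continuous_hessKernel hx).aestronglyMeasurable
  · filter_upwards [Metric.ball_mem_nhds x (half_pos hx)] with x' hx'
    exact ae_of_all _ fun y => norm_smul_hessKernel_le_of_mem_ball hx hx' y
  · exact ae_of_all _ fun y =>
      (continuousAt_dipoleHess (ne_bdryPoint hx y) _).const_smul (f y)

lemma contDiffOn_poissonIntegral (hp : 1 ≤ p) (hf : MemLp f p) :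
    ContDiffOn ℝ 2 (poissonIntegral f) (halfSpace d) := by
  have h1 : ContDiffOn ℝ 1 (gradIntegral f) (halfSpace d) := by
    rw [show (1 : WithTop ℕ∞) = 0 + 1 by simp,
      contDiffOn_succ_iff_fderiv_of_isOpen isOpen_halfSpace]
    refine ⟨fun x hx => (hasFDerivAt_gradIntegral hx hp hf).differentiableAt.differentiableWithinAt,
      by simp, ?_⟩
    rw [contDiffOn_zero]
    refine ContinuousOn.congr (f := fun x => ∫ y, f y • hessKernel x y)
      (fun x hx => (continuousAt_integral_hessKernel hx hp hf).continuousWithinAt) fun x hx => ?_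
    exact (hasFDerivAt_gradIntegral hx hp hf).fderiv
  rw [show (2 : WithTop ℕ∞) = 1 + 1 by norm_num,
    contDiffOn_succ_iff_fderiv_of_isOpen isOpen_halfSpace]
  refine ⟨fun x hx =>
    (hasFDerivAt_poissonIntegral hx hp hf).differentiableAt.differentiableWithinAt,
    by simp, ?_⟩
  refine ContDiffOn.congr ((innerSL ℝ).contDiff.comp_contDiffOn (h1.const_smul
    (2 / sphereArea (d + 1)))) fun x hx => ?_
  exact (hasFDerivAt_poissonIntegral hx hp hf).fderiv

lemma laplacian_poissonIntegral (hp : 1 ≤ p) (hf : MemLp f p)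
    {x : EuclideanSpace ℝ (Fin (d + 1))} (hx : x ∈ halfSpace d) :
    Δ (poissonIntegral f) x = 0 := by
  set b := EuclideanSpace.basisFun (Fin (d + 1)) ℝ with hb
  have h1 : fderiv ℝ (fderiv ℝ (poissonIntegral f)) x = (innerSL ℝ).comp
      ((2 / sphereArea (d + 1)) • ∫ y, f y • hessKernel x y) := by
    have : fderiv ℝ (poissonIntegral f) =ᶠ[𝓝 x]
        fun x => innerSL ℝ ((2 / sphereArea (d + 1)) • gradIntegral f x) := by
      filter_upwards [isOpen_halfSpace.mem_nhds hx] with x hx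
      exact (hasFDerivAt_poissonIntegral hx hp hf).fderiv
    rw [this.fderiv_eq]
    exact ((innerSL ℝ).hasFDerivAt.comp x
      ((hasFDerivAt_gradIntegral hx hp hf).const_smul (2 / sphereArea (d + 1)))).fderiv
  have h2 : ∀ i, Integrable fun y => ⟪(f y • hessKernel x y) (b i), b i⟫ := fun i =>
    ((ContinuousLinearMap.apply ℝ _ (b i)).integrable_comp
      (integrable_smul_hessKernel hx hp hf)).inner_const (b i)
  have h3 : ∀ i, ⟪(∫ y, f y • hessKernel x y) (b i), b i⟫
      = ∫ y, ⟪(f y • hessKernel x y) (b i), b i⟫ := fun i => by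
    rw [ContinuousLinearMap.integral_apply (integrable_smul_hessKernel hx hp hf)]
    have := integral_inner (𝕜 := ℝ) ((ContinuousLinearMap.apply ℝ _ (b i)).integrable_comp
      (integrable_smul_hessKernel hx hp hf)) (b i)
    simp_rw [real_inner_comm _ (b i)] at this
    exact this.symm
  have h4 : ∀ y, ∑ i, ⟪(f y • hessKernel x y) (b i), b i⟫ = 0 := fun y => by
    have := sum_inner_dipoleHess b (inner_normalVec_bdryPoint y) (ne_bdryPoint hx y)
    simp only [smul_apply, inner_smul_left, ← Finset.mul_sum]
    rw [Fintype.card_fin] at this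
    rw [hessKernel, this, mul_zero]
  rw [laplacian_eq_iteratedFDeriv_orthonormalBasis _ b]
  simp only [iteratedFDeriv_two_apply, h1]
  have h5 : ∀ (c : ℝ) (L : EuclideanSpace ℝ (Fin (d + 1)) →L[ℝ] EuclideanSpace ℝ (Fin (d + 1))) v,
      ⟪(c • L) v, v⟫ = c * ⟪L v, v⟫ := fun c L v => by rw [smul_apply, real_inner_smul_left]
  simp only [Matrix.cons_val_zero, Matrix.cons_val_one, ContinuousLinearMap.comp_apply,
    innerSL_apply_apply, h5 (2 / sphereArea (d + 1)), ← Finset.mul_sum, h3]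
  rw [← integral_finsetSum _ fun i _ => h2 i]
  simp only [h4, integral_zero, mul_zero]

/-- Every Poisson integral of an `L^p` function is harmonic, so that it belongs to `h^p`. -/
lemma isHardyWithBoundary_poissonIntegral {p : ℝ} (hp : 1 ≤ p)
    (hf : MemLp f (ENNReal.ofReal p)) : IsHardyWithBoundary p (poissonIntegral f) f where
  harmonic x hx := by
    have hp' : 1 ≤ ENNReal.ofReal p := by simpa using hp
    refine ⟨(contDiffOn_poissonIntegral hp' hf).contDiffAt (isOpen_halfSpace.mem_nhds hx), ?_⟩
    filter_upwards [isOpen_halfSpace.mem_nhds hx] with x hx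
    exact laplacian_poissonIntegral hp' hf hx
  memLp := hf
  eq_poisson _ _ := rfl

lemma IsHardyWithBoundary.hasGradientAt {p : ℝ} (hp : 1 ≤ p)
    {u : EuclideanSpace ℝ (Fin (d + 1)) → ℝ} (hu : IsHardyWithBoundary p u f)
    {x : EuclideanSpace ℝ (Fin (d + 1))} (hx : x ∈ halfSpace d) :
    HasGradientAt u ((2 / sphereArea (d + 1)) • gradIntegral f x) x := by
  have hp' : 1 ≤ ENNReal.ofReal p := by simpa using hp
  have h := hasFDerivAt_poissonIntegral hx hp' hu.memLp
  refine (h.congr_of_eventuallyEq ?_ : HasFDerivAt u _ x)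
  filter_upwards [isOpen_halfSpace.mem_nhds hx] with x hx
  exact hu.eq_poisson x hx

lemma inner_gradIntegral {x : EuclideanSpace ℝ (Fin (d + 1))} (hx : x ∈ halfSpace d)
    (hp : 1 ≤ p) (hf : MemLp f p) (z : EuclideanSpace ℝ (Fin (d + 1))) :
    ⟪gradIntegral f x, z⟫ = ∫ y, ⟪gradKernel x y, z⟫ * f y := by
  rw [real_inner_comm, gradIntegral, ← integral_inner (integrable_smul_gradKernel hx hp hf)]
  simp [inner_smul_right, real_inner_comm, mul_comm]

end Poisson

/-! ### Duality between `L^p` and `L^q` -/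

section Duality

variable {α : Type*} [MeasurableSpace α] {μ : Measure α}

lemma toReal_eLpNorm_ofReal {p : ℝ} (hp : 1 ≤ p) {f : α → ℝ} (hf : MemLp f (ENNReal.ofReal p) μ) :
    (eLpNorm f (ENNReal.ofReal p) μ).toReal = (∫ a, |f a| ^ p ∂μ) ^ (1 / p) := by
  have hp0 : 0 < p := by linarith
  rw [hf.eLpNorm_eq_integral_rpow_norm (by simpa using hp0) ENNReal.ofReal_ne_top,
    ENNReal.toReal_ofReal (by positivity), ENNReal.toReal_ofReal hp0.le, one_div]
  rfl

lemma abs_integral_mul_le {p q : ℝ} (hpq : p.HolderConjugate q) {k f : α → ℝ}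
    (hk : MemLp k (ENNReal.ofReal q) μ) (hf : MemLp f (ENNReal.ofReal p) μ) :
    |∫ a, k a * f a ∂μ| ≤
      (∫ a, |k a| ^ q ∂μ) ^ (1 / q) * (eLpNorm f (ENNReal.ofReal p) μ).toReal := by
  rw [toReal_eLpNorm_ofReal hpq.lt.le hf]
  refine (norm_integral_le_integral_norm (fun a => k a * f a)).trans ?_
  simp_rw [norm_mul]
  exact integral_mul_norm_le_Lp_mul_Lq hpq.symm hk hf

/-- The `L^q` norm of `k` is at most any bound for the functional `f ↦ ∫ k f` on `L^p`; the extremal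
function is `|k|^(q - 2) k`. -/
lemma rpow_integral_le_of_forall_abs_integral_le {p q : ℝ} (hpq : p.HolderConjugate q)
    {k : α → ℝ} (hk : MemLp k (ENNReal.ofReal q) μ) {C : ℝ} (hC : 0 ≤ C)
    (h : ∀ f, MemLp f (ENNReal.ofReal p) μ →
      |∫ a, k a * f a ∂μ| ≤ C * (eLpNorm f (ENNReal.ofReal p) μ).toReal) :
    (∫ a, |k a| ^ q ∂μ) ^ (1 / q) ≤ C := by
  have hq0 : 0 < q := hpq.symm.pos
  have hp0 : 0 < p := hpq.pos
  have hq1 : 1 < q := hpq.symm.lt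
  set f : α → ℝ := fun a => |k a| ^ (q - 2) * k a with hf
  have habs : ∀ a, |f a| = |k a| ^ (q - 1) := fun a => by
    rcases eq_or_ne (k a) 0 with h0 | h0
    · simp [hf, h0, Real.zero_rpow (sub_ne_zero.2 hq1.ne')]
    · rw [hf]
      simp only
      rw [abs_mul, abs_of_nonneg (by positivity), ← Real.rpow_add_one (abs_ne_zero.2 h0)]
      congr 1
      ring
  have hfp : ∀ a, |f a| ^ p = |k a| ^ q := fun a => by
    rw [habs, ← Real.rpow_mul (abs_nonneg _), hpq.symm.sub_one_mul_conj]
  have hkf : ∀ a, k a * f a = |k a| ^ q := fun a => by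
    rcases eq_or_ne (k a) 0 with h0 | h0
    · simp [h0, Real.zero_rpow hq0.ne']
    · have : k a * f a = |k a| ^ (q - 2) * |k a| ^ (2 : ℝ) := by
        rw [Real.rpow_two, sq_abs]
        simp only [hf]
        ring
      rw [this, ← Real.rpow_add (abs_pos.2 h0)]
      congr 1
      ring
  have hint : Integrable (fun a => |k a| ^ q) μ := by
    have := hk.integrable_norm_rpow (by simpa using hq0) ENNReal.ofReal_ne_top
    rwa [ENNReal.toReal_ofReal hq0.le] at this
  have hfm : AEStronglyMeasurable f μ :=
    ((hk.1.aemeasurable.norm.pow_const _).mul hk.1.aemeasurable).aestronglyMeasurable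
  have hfL : MemLp f (ENNReal.ofReal p) μ := by
    rw [← integrable_norm_rpow_iff hfm (by simpa using hp0) ENNReal.ofReal_ne_top,
      ENNReal.toReal_ofReal hp0.le]
    exact hint.congr (ae_of_all _ fun a => (hfp a).symm)
  have key := h f hfL
  rw [toReal_eLpNorm_ofReal hpq.lt.le hfL] at key
  simp_rw [hkf, hfp] at key
  set A := ∫ a, |k a| ^ q ∂μ with hA
  have hA0 : 0 ≤ A := integral_nonneg fun a => by positivity
  rcases hA0.eq_or_lt with h0 | h0
  · rw [← h0, Real.zero_rpow (by positivity)]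
    exact hC
  · rw [abs_of_pos h0] at key
    have h1 : A ^ (1 / q) * A ^ (1 / p) = A := by
      rw [← Real.rpow_add h0]
      have := hpq.inv_add_inv_eq_one
      rw [one_div, one_div, add_comm, this, Real.rpow_one]
    nth_rewrite 1 [← h1] at key
    exact le_of_mul_le_mul_right key (by positivity)

variable [TopologicalSpace α] [OpensMeasurableSpace α] [μ.IsOpenPosMeasure]
  [IsLocallyFiniteMeasure μ]

/-- A bound for the functional `f ↦ ∫ k f` on `L¹` bounds `k` at its points of continuity, by
testing against indicators of shrinking neighbourhoods. -/
lemma abs_le_of_forall_abs_integral_le {k : α → ℝ} {y : α} (hk : ContinuousAt k y) {C : ℝ}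
    (h : ∀ f, MemLp f 1 μ → |∫ a, k a * f a ∂μ| ≤ C * (eLpNorm f 1 μ).toReal)
    (hki : LocallyIntegrable k μ) : |k y| ≤ C := by
  wlog hpos : 0 ≤ k y generalizing k
  · have := this (k := fun a => -k a) hk.neg (fun f hf => by
      simpa [integral_neg] using h f hf) hki.neg (by linarith)
    simpa using this
  rw [abs_of_nonneg hpos]
  by_contra! hlt
  obtain ⟨C', hC', hC'k⟩ := exists_between hlt
  obtain ⟨U, hU, hUint⟩ := hki y
  obtain ⟨W, hW, hWfin⟩ := μ.exists_isOpen_measure_lt_top y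
  obtain ⟨T, hTsub, hT, hyT⟩ := mem_nhds_iff.1 (inter_mem hU
    (inter_mem (hWfin.1.mem_nhds hW) (hk.eventually (lt_mem_nhds hC'k))))
  have hTfin : μ T < ⊤ := (measure_mono fun a ha => (hTsub ha).2.1).trans_lt hWfin.2
  have hTpos : 0 < μ.real T := ENNReal.toReal_pos (hT.measure_pos μ ⟨y, hyT⟩).ne' hTfin.ne
  have hm : MemLp (T.indicator fun _ => (1 : ℝ)) 1 μ :=
    memLp_indicator_const 1 hT.measurableSet 1 (Or.inr hTfin.ne)
  have h1 := h _ hm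
  have h2 : (fun a => k a * T.indicator (fun _ => (1 : ℝ)) a) = T.indicator k := by
    ext a
    by_cases ha : a ∈ T <;> simp [ha]
  rw [h2, integral_indicator hT.measurableSet,
    eLpNorm_indicator_const hT.measurableSet one_ne_zero ENNReal.one_ne_top] at h1
  have h3 : C' * μ.real T ≤ ∫ a in T, k a ∂μ := by
    have : ∫ a in T, C' ∂μ ≤ ∫ a in T, k a ∂μ :=
      setIntegral_mono_on (integrableOn_const hTfin.ne)
        (hUint.mono_set fun a ha => (hTsub ha).1) hT.measurableSet
        fun a ha => (hTsub ha).2.2.le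
    rwa [setIntegral_const, smul_eq_mul, mul_comm] at this
  have h4 : (‖(1 : ℝ)‖ₑ * μ T ^ (1 / (1 : ENNReal).toReal)).toReal = μ.real T := by
    simp [measureReal_def]
  rw [h4] at h1
  have := (le_abs_self _).trans h1
  nlinarith

end Duality

/-! ### The sharp coefficient as a supremum over directions -/

section SharpCoefficient

variable {d : ℕ}

/-- The component in direction `z` of the gradient of the Poisson kernel at the point `e_n` of
height one, as a function of the pole, up to the factor `2 / ω_n`. -/
noncomputable def profile (z : EuclideanSpace ℝ (Fin (d + 1))) (t : EuclideanSpace ℝ (Fin d)) : ℝ :=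
  ⟪gradKernel (normalVec d) t, z⟫

/-- The `L^q` norm of `profile z`: the norm of `u ↦ ∂u/∂z (e_n)` on `h^p`, up to the factor
`2 / ω_n`, where `q` is the conjugate exponent of `p`. -/
noncomputable def dirNorm (q : ℝ) (z : EuclideanSpace ℝ (Fin (d + 1))) : ℝ :=
  (∫ t, |profile z t| ^ q) ^ (1 / q)

lemma normalVec_last : normalVec d (Fin.last d) = 1 := by simp [normalVec]

lemma normalVec_mem_halfSpace : normalVec d ∈ halfSpace d := by
  show 0 < normalVec d (Fin.last d)
  rw [normalVec_last]
  exact one_pos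

lemma horiz_normalVec : horiz (normalVec d) = 0 := by
  ext i
  simp [horiz, normalVec, Fin.castSucc_ne_last]

lemma inner_eq_horiz (x z : EuclideanSpace ℝ (Fin (d + 1))) :
    ⟪x, z⟫ = ⟪horiz x, horiz z⟫ + x (Fin.last d) * z (Fin.last d) := by
  simp [PiLp.inner_apply, Fin.sum_univ_castSucc, horiz, mul_comm]

lemma inner_gradKernel (x z : EuclideanSpace ℝ (Fin (d + 1))) (y : EuclideanSpace ℝ (Fin d)) :
    ⟪gradKernel x y, z⟫ =
      (‖horiz x - y‖ ^ 2 + x (Fin.last d) ^ 2) ^ (-((d + 1 : ℕ) : ℝ) / 2) * z (Fin.last d) -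
      (((d + 1 : ℕ) : ℝ) * x (Fin.last d) *
        (‖horiz x - y‖ ^ 2 + x (Fin.last d) ^ 2) ^ (-((d + 1 : ℕ) : ℝ) / 2 - 1)) *
      (⟪horiz x - y, horiz z⟫ + x (Fin.last d) * z (Fin.last d)) := by
  rw [gradKernel, dipoleGrad, inner_sub_left, real_inner_smul_left, real_inner_smul_left,
    inner_normalVec, inner_normalVec, norm_sq_sub_bdryPoint, inner_eq_horiz (x - bdryPoint y) z,
    horiz_sub_bdryPoint]
  simp [bdryPoint_last]

lemma profile_eq (z : EuclideanSpace ℝ (Fin (d + 1))) (t : EuclideanSpace ℝ (Fin d)) :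
    profile z t = (1 + ‖t‖ ^ 2) ^ (-((d + 1 : ℕ) : ℝ) / 2) * z (Fin.last d) -
      ((d + 1 : ℕ) : ℝ) * (1 + ‖t‖ ^ 2) ^ (-((d + 1 : ℕ) : ℝ) / 2 - 1) *
        (z (Fin.last d) - ⟪t, horiz z⟫) := by
  rw [profile, inner_gradKernel, normalVec_last, horiz_normalVec, zero_sub, norm_neg,
    inner_neg_left, one_pow, add_comm (‖t‖ ^ 2)]
  ring

/-- Translations parallel to the boundary and dilations reduce the gradient at `x` to the gradient
at the point `e_n`. -/
lemma inner_gradKernel_horiz_add_smul {x : EuclideanSpace ℝ (Fin (d + 1))} (hx : x ∈ halfSpace d)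
    (z : EuclideanSpace ℝ (Fin (d + 1))) (t : EuclideanSpace ℝ (Fin d)) :
    ⟪gradKernel x (horiz x + x (Fin.last d) • t), z⟫ =
      x (Fin.last d) ^ (-((d + 1 : ℕ) : ℝ)) * profile z t := by
  have hx' : 0 < x (Fin.last d) := hx
  rw [inner_gradKernel, profile_eq, sub_add_cancel_left, norm_neg, norm_smul, inner_neg_left,
    real_inner_smul_left, Real.norm_of_nonneg hx'.le]
  set h := x (Fin.last d)
  set n : ℝ := ((d + 1 : ℕ) : ℝ)
  have h1 : (h * ‖t‖) ^ 2 + h ^ 2 = h ^ 2 * (1 + ‖t‖ ^ 2) := by ring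
  have h2 : ∀ s : ℝ, (h ^ 2 * (1 + ‖t‖ ^ 2)) ^ s = h ^ (2 * s) * (1 + ‖t‖ ^ 2) ^ s := fun s => by
    rw [Real.mul_rpow (by positivity) (by positivity), ← Real.rpow_natCast h 2,
      ← Real.rpow_mul hx'.le]
    norm_cast
  have h3 : h ^ (-n) = h ^ (2 * (-n / 2 - 1)) * h ^ 2 := by
    rw [← Real.rpow_natCast h 2, ← Real.rpow_add hx']
    congr 1
    push_cast
    ring
  rw [h1, h2, h2, show 2 * (-n / 2) = -n by ring, h3]
  ring

lemma memLp_inner_gradKernel {x : EuclideanSpace ℝ (Fin (d + 1))} (hx : x ∈ halfSpace d)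
    (z : EuclideanSpace ℝ (Fin (d + 1))) {q : ENNReal} (hq : 1 ≤ q) :
    MemLp (fun y => ⟪gradKernel x y, z⟫) q :=
  (memLp_gradKernel hx hq).inner_const z

lemma integrable_abs_profile_rpow (z : EuclideanSpace ℝ (Fin (d + 1))) {q : ℝ} (hq : 1 ≤ q) :
    Integrable fun t => |profile z t| ^ q := by
  have hq0 : 0 < q := by linarith
  have := (memLp_inner_gradKernel normalVec_mem_halfSpace z (q := ENNReal.ofReal q)
    (by simpa using hq)).integrable_norm_rpow (by simpa using hq0) ENNReal.ofReal_ne_top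
  rwa [ENNReal.toReal_ofReal hq0.le] at this

lemma integral_comp_horiz_add_smul {x : EuclideanSpace ℝ (Fin (d + 1))} (hx : x ∈ halfSpace d)
    (g : EuclideanSpace ℝ (Fin d) → ℝ) :
    ∫ y, g y = x (Fin.last d) ^ d * ∫ t, g (horiz x + x (Fin.last d) • t) := by
  have hx' : 0 < x (Fin.last d) := hx
  rw [Measure.integral_comp_smul volume (fun t => g (horiz x + t)), integral_add_left_eq_self,
    finrank_euclideanSpace_fin, smul_eq_mul, abs_of_pos (by positivity), ← mul_assoc,
    mul_inv_cancel₀ (by positivity), one_mul]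

lemma rpow_integral_abs_inner_gradKernel {x : EuclideanSpace ℝ (Fin (d + 1))}
    (hx : x ∈ halfSpace d) {p q : ℝ} (hpq : p.HolderConjugate q)
    (z : EuclideanSpace ℝ (Fin (d + 1))) :
    (∫ y, |⟪gradKernel x y, z⟫| ^ q) ^ (1 / q) =
      dirNorm q z * x (Fin.last d) ^ ((1 - ((d + 1 : ℕ) : ℝ) - p) / p) := by
  have hx' : 0 < x (Fin.last d) := hx
  have hq0 : 0 < q := hpq.symm.pos
  have hp0 : 0 < p := hpq.pos
  rw [integral_comp_horiz_add_smul hx]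
  simp_rw [inner_gradKernel_horiz_add_smul hx, abs_mul, Real.mul_rpow (abs_nonneg _) (abs_nonneg _)]
  rw [integral_const_mul, abs_of_nonneg (by positivity), ← mul_assoc,
    Real.mul_rpow (by positivity) (integral_nonneg fun t => by positivity), dirNorm, mul_comm]
  congr 1
  rw [← Real.rpow_natCast, ← Real.rpow_mul hx'.le, ← Real.rpow_add hx', ← Real.rpow_mul hx'.le]
  congr 1
  have h1 : 1 / q = 1 - 1 / p := by
    have := hpq.inv_add_inv_eq_one
    rw [one_div, one_div]
    linarith
  have h2 : (d + -((d + 1 : ℕ) : ℝ) * q) * (1 / q) = d * (1 / q) - ((d + 1 : ℕ) : ℝ) := by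
    field_simp
    ring
  rw [h2, h1]
  push_cast
  field_simp
  ring

lemma dirNorm_nonneg (q : ℝ) (z : EuclideanSpace ℝ (Fin (d + 1))) : 0 ≤ dirNorm q z :=
  Real.rpow_nonneg (integral_nonneg fun t => by positivity) _

lemma dirNorm_le_mul_norm {q : ℝ} (hq : 1 ≤ q) : ∃ M : ℝ, 0 ≤ M ∧
    ∀ z : EuclideanSpace ℝ (Fin (d + 1)), dirNorm q z ≤ M * ‖z‖ := by
  have hq0 : 0 < q := by linarith
  have hint := (memLp_gradKernel (d := d) normalVec_mem_halfSpace (q := ENNReal.ofReal q)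
    (by simpa using hq)).integrable_norm_rpow (by simpa using hq0) ENNReal.ofReal_ne_top
  rw [ENNReal.toReal_ofReal hq0.le] at hint
  refine ⟨(∫ t, ‖gradKernel (normalVec d) t‖ ^ q) ^ (1 / q), by positivity, fun z => ?_⟩
  have h1 : ∫ t, |profile z t| ^ q ≤ (∫ t, ‖gradKernel (normalVec d) t‖ ^ q) * ‖z‖ ^ q := by
    rw [← integral_mul_const]
    refine integral_mono (integrable_abs_profile_rpow z hq) (hint.mul_const _) fun t => ?_
    simp only
    rw [← Real.mul_rpow (norm_nonneg _) (norm_nonneg _)]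
    exact Real.rpow_le_rpow (abs_nonneg _) (abs_real_inner_le_norm _ _) hq0.le
  calc dirNorm q z ≤ ((∫ t, ‖gradKernel (normalVec d) t‖ ^ q) * ‖z‖ ^ q) ^ (1 / q) :=
        Real.rpow_le_rpow (integral_nonneg fun t => by positivity) h1 (by positivity)
    _ = _ := by
        rw [Real.mul_rpow (integral_nonneg fun t => by positivity) (by positivity),
          ← Real.rpow_mul (norm_nonneg z), mul_one_div_cancel hq0.ne', Real.rpow_one]

lemma bddAbove_dirNorm {q : ℝ} (hq : 1 ≤ q) : BddAbove (Set.range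
    fun z : Metric.sphere (0 : EuclideanSpace ℝ (Fin (d + 1))) 1 => dirNorm q z.1) := by
  obtain ⟨M, -, hM⟩ := dirNorm_le_mul_norm (d := d) hq
  refine ⟨M, ?_⟩
  rintro _ ⟨z, rfl⟩
  simpa [norm_eq_of_mem_sphere z] using hM z.1

lemma sphereArea_pos {k : ℕ} (hk : 0 < k) : 0 < sphereArea k := by
  have : Nonempty (Fin k) := ⟨⟨0, hk⟩⟩
  have : Nontrivial (EuclideanSpace ℝ (Fin k)) := Module.nontrivial_of_finrank_pos (R := ℝ)
    (by simpa using hk)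
  exact ENNReal.toReal_pos (Measure.measure_univ_ne_zero.2 (Measure.toSphere_ne_zero _))
    (measure_ne_top _ _)

variable {p : ℝ} {f : EuclideanSpace ℝ (Fin d) → ℝ} {u : EuclideanSpace ℝ (Fin (d + 1)) → ℝ}
  {x : EuclideanSpace ℝ (Fin (d + 1))}

lemma IsHardyWithBoundary.inner_gradient (hp : 1 ≤ p) (hu : IsHardyWithBoundary p u f)
    (hx : x ∈ halfSpace d) (z : EuclideanSpace ℝ (Fin (d + 1))) :
    ⟪gradient u x, z⟫ = 2 / sphereArea (d + 1) * ∫ y, ⟪gradKernel x y, z⟫ * f y := by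
  rw [(hu.hasGradientAt hp hx).gradient, real_inner_smul_left,
    inner_gradIntegral hx (by simpa using hp) hu.memLp]

lemma IsHardyWithBoundary.lineDeriv_normalVec (hp : 1 ≤ p) (hu : IsHardyWithBoundary p u f)
    (hx : x ∈ halfSpace d) :
    lineDeriv ℝ u x (EuclideanSpace.single (Fin.last d) (1 : ℝ)) =
      ⟪gradient u x, normalVec d⟫ := by
  have h := hu.hasGradientAt hp hx
  have h' : HasFDerivAt u _ x := h.hasFDerivAt
  rw [h.gradient, (h'.hasLineDerivAt _).lineDeriv]
  rfl

lemma gradientCoeffs_subset_normalCoeffs (hp : 1 ≤ p) (hx : x ∈ halfSpace d) :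
    gradientCoeffs p x ⊆ normalCoeffs p x := by
  intro C hC u f hu
  rw [hu.lineDeriv_normalVec hp hx]
  refine le_trans ?_ (hC u f hu)
  simpa [norm_normalVec] using abs_real_inner_le_norm (gradient u x) (normalVec d)

lemma abs_integral_le_of_mem_normalCoeffs (hp : 1 ≤ p) (hx : x ∈ halfSpace d) {C : ℝ}
    (hC : C ∈ normalCoeffs p x) (hf : MemLp f (ENNReal.ofReal p)) :
    |∫ y, ⟪gradKernel x y, normalVec d⟫ * f y| ≤
      (C / (2 / sphereArea (d + 1))) * (eLpNorm f (ENNReal.ofReal p) volume).toReal := by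
  have hω := sphereArea_pos (Nat.succ_pos d)
  have hu := isHardyWithBoundary_poissonIntegral hp hf
  have h := hC _ f hu
  rw [hu.lineDeriv_normalVec hp hx, hu.inner_gradient hp hx, abs_mul,
    abs_of_pos (by positivity)] at h
  rw [div_mul_eq_mul_div, le_div_iff₀ (by positivity), mul_comm]
  exact h

lemma abs_integral_le_of_mem_gradientCoeffs (hp : 1 ≤ p) (hx : x ∈ halfSpace d) {C : ℝ}
    (hC : C ∈ gradientCoeffs p x) (hf : MemLp f (ENNReal.ofReal p))
    {z : EuclideanSpace ℝ (Fin (d + 1))} (hz : ‖z‖ = 1) :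
    |∫ y, ⟪gradKernel x y, z⟫ * f y| ≤
      (C / (2 / sphereArea (d + 1))) * (eLpNorm f (ENNReal.ofReal p) volume).toReal := by
  have hω := sphereArea_pos (Nat.succ_pos d)
  have hu := isHardyWithBoundary_poissonIntegral hp hf
  have h := hC _ f hu
  have h2 := (abs_real_inner_le_norm (gradient (poissonIntegral f) x) z)
  rw [hz, mul_one, hu.inner_gradient hp hx, abs_mul, abs_of_pos (by positivity)] at h2
  rw [div_mul_eq_mul_div, le_div_iff₀ (by positivity), mul_comm]
  exact h2.trans h

lemma nonneg_of_mem_normalCoeffs (hp : 1 ≤ p) {C : ℝ} (hC : C ∈ normalCoeffs p x) : 0 ≤ C := by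
  have hp0 : 0 < p := by linarith
  set B := Metric.ball (0 : EuclideanSpace ℝ (Fin d)) 1
  have hBfin : volume B ≠ ⊤ := measure_ball_lt_top.ne
  have hB0 : volume B ≠ 0 := (Metric.measure_ball_pos volume 0 one_pos).ne'
  have hm : MemLp (B.indicator fun _ => (1 : ℝ)) (ENNReal.ofReal p) volume :=
    memLp_indicator_const _ measurableSet_ball 1 (Or.inr hBfin)
  have h := (abs_nonneg _).trans (hC _ _ (isHardyWithBoundary_poissonIntegral hp hm))
  refine nonneg_of_mul_nonneg_left h (ENNReal.toReal_pos ?_ hm.2.ne)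
  rw [eLpNorm_indicator_const measurableSet_ball (by simpa using hp0) ENNReal.ofReal_ne_top]
  exact mul_ne_zero (by simp) (ENNReal.rpow_pos (pos_iff_ne_zero.2 hB0) hBfin).ne'

lemma norm_gradient_le_of_forall (hp : 1 ≤ p) (hx : x ∈ halfSpace d) {C : ℝ} (hC : 0 ≤ C)
    (hu : IsHardyWithBoundary p u f)
    (h : ∀ z, ‖z‖ = 1 → |∫ y, ⟪gradKernel x y, z⟫ * f y| ≤
      C * (eLpNorm f (ENNReal.ofReal p) volume).toReal) :
    ‖gradient u x‖ ≤ 2 / sphereArea (d + 1) * C *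
      (eLpNorm f (ENNReal.ofReal p) volume).toReal := by
  have hω := sphereArea_pos (Nat.succ_pos d)
  rcases eq_or_ne (gradient u x) 0 with h0 | h0
  · rw [h0, norm_zero]
    positivity
  · have hn : 0 < ‖gradient u x‖ := norm_pos_iff.2 h0
    have h1 := h (‖gradient u x‖⁻¹ • gradient u x) (by rw [norm_smul, norm_inv, norm_norm,
      inv_mul_cancel₀ hn.ne'])
    have h2 := hu.inner_gradient hp hx (‖gradient u x‖⁻¹ • gradient u x)
    rw [real_inner_smul_right, real_inner_self_eq_norm_sq, pow_two, ← mul_assoc,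
      inv_mul_cancel₀ hn.ne', one_mul] at h2
    rw [h2, mul_assoc]
    exact mul_le_mul_of_nonneg_left ((le_abs_self _).trans h1) (by positivity)

lemma isLeast_gradientCoeffs {q : ℝ} (hpq : p.HolderConjugate q) (hx : x ∈ halfSpace d) :
    IsLeast (gradientCoeffs p x) (2 / sphereArea (d + 1) *
      (⨆ z : Metric.sphere (0 : EuclideanSpace ℝ (Fin (d + 1))) 1, dirNorm q z.1) *
      x (Fin.last d) ^ ((1 - ((d + 1 : ℕ) : ℝ) - p) / p)) := by
  have hx' : 0 < x (Fin.last d) := hx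
  have hω := sphereArea_pos (Nat.succ_pos d)
  have hp : 1 ≤ p := hpq.lt.le
  have hq : 1 ≤ q := hpq.symm.lt.le
  have hq' : 1 ≤ ENNReal.ofReal q := by simpa using hq
  have hbdd := bddAbove_dirNorm (d := d) hq
  constructor
  · intro u f hu
    rw [mul_assoc (2 / sphereArea (d + 1))]
    refine norm_gradient_le_of_forall hp hx (mul_nonneg (Real.iSup_nonneg fun z =>
      dirNorm_nonneg _ _) (by positivity)) hu fun z hz => ?_
    refine (abs_integral_mul_le hpq (memLp_inner_gradKernel hx z hq') hu.memLp).trans ?_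
    rw [rpow_integral_abs_inner_gradKernel hx hpq]
    gcongr
    exact le_ciSup hbdd ⟨z, by simpa using hz⟩
  · intro C hC
    have hC0 := nonneg_of_mem_normalCoeffs hp (gradientCoeffs_subset_normalCoeffs hp hx hC)
    have : Nonempty (Metric.sphere (0 : EuclideanSpace ℝ (Fin (d + 1))) 1) :=
      ⟨⟨normalVec d, by simp [norm_normalVec]⟩⟩
    rw [mul_assoc, ← le_div_iff₀' (by positivity), ← le_div_iff₀ (by positivity)]
    refine ciSup_le fun z => ?_
    rw [le_div_iff₀ (by positivity), ← rpow_integral_abs_inner_gradKernel hx hpq]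
    refine rpow_integral_le_of_forall_abs_integral_le hpq (memLp_inner_gradKernel hx z.1 hq')
      (by positivity) fun f hf => ?_
    exact abs_integral_le_of_mem_gradientCoeffs hp hx hC hf (norm_eq_of_mem_sphere z)

lemma isLeast_normalCoeffs {q : ℝ} (hpq : p.HolderConjugate q) (hx : x ∈ halfSpace d) :
    IsLeast (normalCoeffs p x) (2 / sphereArea (d + 1) * dirNorm q (normalVec d) *
      x (Fin.last d) ^ ((1 - ((d + 1 : ℕ) : ℝ) - p) / p)) := by
  have hx' : 0 < x (Fin.last d) := hx
  have hω := sphereArea_pos (Nat.succ_pos d)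
  have hp : 1 ≤ p := hpq.lt.le
  have hq' : 1 ≤ ENNReal.ofReal q := by simpa using hpq.symm.lt.le
  rw [mul_assoc, ← rpow_integral_abs_inner_gradKernel hx hpq]
  constructor
  · intro u f hu
    rw [hu.lineDeriv_normalVec hp hx, hu.inner_gradient hp hx, abs_mul,
      abs_of_pos (by positivity), mul_assoc]
    gcongr
    exact abs_integral_mul_le hpq (memLp_inner_gradKernel hx _ hq') hu.memLp
  · intro C hC
    have hC0 := nonneg_of_mem_normalCoeffs hp hC
    rw [← le_div_iff₀' (by positivity)]
    exact rpow_integral_le_of_forall_abs_integral_le hpq (memLp_inner_gradKernel hx _ hq')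
      (by positivity) fun f hf => abs_integral_le_of_mem_normalCoeffs hp hx hC hf

/-! ### The case `p = 1` -/

/-- The pointwise bound behind `C₁`: with `c` the cosine of the angle between `e_n` and `x - y`, the
squared norm is `x_n^(-2n) c^(2n) (1 + n (n - 2) c²)`, which is largest at `c = 1`. -/
lemma norm_gradKernel_le_last (hd : 1 ≤ d) (hx : x ∈ halfSpace d)
    (y : EuclideanSpace ℝ (Fin d)) :
    ‖gradKernel x y‖ ≤ d * x (Fin.last d) ^ (-((d + 1 : ℕ) : ℝ)) := by
  have hx' : 0 < x (Fin.last d) := hx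
  have hd' : (1 : ℝ) ≤ d := by exact_mod_cast hd
  set h := x (Fin.last d) with hh
  set n : ℝ := ((d + 1 : ℕ) : ℝ) with hn
  have hnd : n = d + 1 := by rw [hn]; push_cast; rfl
  have hS := normSq_sub_bdryPoint_pos hx y
  set S := ‖x - bdryPoint y‖ ^ 2 with hSdef
  have hhS : h ^ 2 ≤ S := by
    rw [hSdef, norm_sq_sub_bdryPoint]
    exact le_add_of_nonneg_left (sq_nonneg _)
  have h1 : gradKernel x y = S ^ (-n / 2) • (normalVec d - (n * h / S) • (x - bdryPoint y)) := by
    rw [gradKernel, dipoleGrad, inner_normalVec, smul_sub (S ^ (-n / 2)), smul_smul, ← hn, ← hSdef,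
      ← hh,
      Real.rpow_sub_one hS.ne']
    congr 2
    ring
  have h2 : ‖normalVec d - (n * h / S) • (x - bdryPoint y)‖ ^ 2 ≤ d ^ 2 := by
    rw [norm_sub_sq_real, norm_normalVec, real_inner_smul_right, norm_smul, mul_pow,
      inner_sub_right, inner_normalVec_bdryPoint, inner_normalVec, ← hh, ← hSdef,
      Real.norm_eq_abs, sq_abs]
    have : 1 ^ 2 - 2 * (n * h / S * (h - 0)) + (n * h / S) ^ 2 * S
        = 1 + n * (n - 2) * (h ^ 2 / S) := by
      field_simp
      ring
    rw [this]
    have h3 : h ^ 2 / S ≤ 1 := (div_le_one hS).2 hhS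
    have h4 : 0 ≤ n * (n - 2) := by rw [hnd]; nlinarith
    have h5 : n * (n - 2) * (h ^ 2 / S) ≤ n * (n - 2) * 1 := by gcongr
    rw [hnd] at h5 ⊢
    nlinarith
  have h3 : ‖normalVec d - (n * h / S) • (x - bdryPoint y)‖ ≤ d :=
    (pow_le_pow_iff_left₀ (norm_nonneg _) (by positivity) two_ne_zero).1 h2
  have h4 : S ^ (-n / 2) ≤ h ^ (-n) := by
    have : h ^ (-n) = (h ^ 2) ^ (-n / 2) := by
      rw [← Real.rpow_natCast h 2, ← Real.rpow_mul hx'.le]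
      congr 1
      push_cast
      ring
    rw [this]
    refine Real.rpow_le_rpow_of_nonpos (by positivity) hhS ?_
    rw [hnd]
    linarith
  rw [h1, norm_smul, Real.norm_of_nonneg (by positivity), mul_comm]
  gcongr

lemma abs_inner_gradKernel_horiz (hx : x ∈ halfSpace d) :
    |⟪gradKernel x (horiz x), normalVec d⟫| = d * x (Fin.last d) ^ (-((d + 1 : ℕ) : ℝ)) := by
  have hx' : 0 < x (Fin.last d) := hx
  have h := inner_gradKernel_horiz_add_smul hx (normalVec d) 0
  rw [smul_zero, add_zero] at h
  rw [h, profile_eq, normalVec_last]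
  simp only [norm_zero, inner_zero_left]
  rw [abs_mul, abs_of_nonneg (by positivity), mul_comm]
  congr 1
  norm_num

lemma mem_gradientCoeffs_one_and_mem_lowerBounds (hd : 1 ≤ d) (hx : x ∈ halfSpace d) :
    2 / sphereArea (d + 1) * d * x (Fin.last d) ^ (-((d + 1 : ℕ) : ℝ)) ∈ gradientCoeffs 1 x ∧
    2 / sphereArea (d + 1) * d * x (Fin.last d) ^ (-((d + 1 : ℕ) : ℝ)) ∈
      lowerBounds (normalCoeffs 1 x) := by
  have hx' : 0 < x (Fin.last d) := hx
  have hω := sphereArea_pos (Nat.succ_pos d)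
  constructor
  · intro u f hu
    rw [mul_assoc (2 / sphereArea (d + 1))]
    refine norm_gradient_le_of_forall le_rfl hx (by positivity) hu fun z hz => ?_
    have hf1 : MemLp f 1 := by simpa using hu.memLp
    have hf : Integrable f := memLp_one_iff_integrable.1 hf1
    rw [toReal_eLpNorm_ofReal le_rfl hu.memLp]
    simp only [Real.rpow_one, div_one]
    rw [← integral_const_mul]
    rw [← Real.norm_eq_abs]
    refine norm_integral_le_of_norm_le (hf.abs.const_mul _) (ae_of_all _ fun y => ?_)
    rw [norm_mul, Real.norm_eq_abs (f y)]
    refine mul_le_mul_of_nonneg_right ?_ (abs_nonneg _)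
    refine le_trans ?_ (norm_gradKernel_le_last hd hx y)
    simpa [hz] using abs_real_inner_le_norm (gradKernel x y) z
  · intro C hC
    rw [mul_assoc, ← le_div_iff₀' (by positivity), ← abs_inner_gradKernel_horiz hx]
    have hk : Continuous fun y => ⟪gradKernel x y, normalVec d⟫ :=
      (continuous_gradKernel hx).inner continuous_const
    refine abs_le_of_forall_abs_integral_le (μ := volume) hk.continuousAt (fun f hf => ?_)
      hk.locallyIntegrable
    simpa using abs_integral_le_of_mem_normalCoeffs le_rfl hx hC (f := f) (by simpa using hf)

end SharpCoefficient

/-! ### Integrals of powers of `1 + |t|²` -/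

section Japanese

variable {V : Type*} [NormedAddCommGroup V] [InnerProductSpace ℝ V] [FiniteDimensional ℝ V]
  [MeasurableSpace V] [BorelSpace V]

/-- Writing `(1 + |t|²)^(-s)` as a Gamma integral of Gaussians and exchanging the integrals. -/
lemma integral_one_add_norm_sq_rpow {s : ℝ} (hs : (Module.finrank ℝ V : ℝ) / 2 < s) :
    ∫ t : V, (1 + ‖t‖ ^ 2) ^ (-s) =
      Real.pi ^ ((Module.finrank ℝ V : ℝ) / 2) * Real.Gamma (s - (Module.finrank ℝ V : ℝ) / 2) /
        Real.Gamma s := by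
  set m : ℝ := (Module.finrank ℝ V : ℝ) / 2 with hm
  have hm0 : 0 ≤ m := by positivity
  have hs0 : 0 < s := hm0.trans_lt hs
  have hG := Real.Gamma_pos_of_pos hs0
  have hG' := Real.Gamma_pos_of_pos (sub_pos.2 hs)
  set F : V → ℝ → ℝ := fun t u => u ^ (s - 1) * Real.exp (-((1 + ‖t‖ ^ 2) * u)) with hF
  have hinner : ∀ t : V, ∫ u in Set.Ioi (0 : ℝ), F t u = (1 + ‖t‖ ^ 2) ^ (-s) * Real.Gamma s := by
    intro t
    have h1 : (0 : ℝ) < 1 + ‖t‖ ^ 2 := by positivity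
    rw [hF, Real.integral_rpow_mul_exp_neg_mul_Ioi hs0 h1, one_div, Real.inv_rpow h1.le,
      Real.rpow_neg h1.le]
  have hsplit : ∀ (t : V) (u : ℝ), F t u = u ^ (s - 1) * Real.exp (-u) *
      Real.exp (-u * ‖t‖ ^ 2) := fun t u => by
    simp only [hF]
    rw [mul_assoc, ← Real.exp_add]
    ring_nf
  have hgauss : ∀ u ∈ Set.Ioi (0 : ℝ), ∫ t : V, F t u =
      Real.pi ^ m * (u ^ (s - m - 1) * Real.exp (-(1 * u))) := by
    intro u hu
    have hu' : 0 < u := hu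
    simp_rw [hsplit]
    rw [integral_const_mul, GaussianFourier.integral_rexp_neg_mul_sq_norm hu', ← hm,
      Real.div_rpow Real.pi_pos.le hu'.le, show s - m - 1 = (s - 1) - m by ring,
      Real.rpow_sub hu' (s - 1) m, one_mul]
    ring
  have houter : ∫ u in Set.Ioi (0 : ℝ), Real.pi ^ m * (u ^ (s - m - 1) * Real.exp (-(1 * u))) =
      Real.pi ^ m * Real.Gamma (s - m) := by
    rw [integral_const_mul, Real.integral_rpow_mul_exp_neg_mul_Ioi (sub_pos.2 hs) one_pos]
    simp
  have hint : Integrable (Function.uncurry F)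
      (volume.prod (volume.restrict (Set.Ioi (0 : ℝ)))) := by
    have hmeas : AEStronglyMeasurable (Function.uncurry F)
        (volume.prod (volume.restrict (Set.Ioi (0 : ℝ)))) := by
      apply Measurable.aestronglyMeasurable
      simp only [hF, Function.uncurry_def]
      fun_prop
    refine (integrable_prod_iff' hmeas).2 ⟨?_, ?_⟩
    · filter_upwards [ae_restrict_mem measurableSet_Ioi] with u hu
      have hu' : 0 < u := hu
      have : Integrable fun t : V => Real.exp (-u * ‖t‖ ^ 2) :=
        .of_integral_ne_zero (by
          rw [GaussianFourier.integral_rexp_neg_mul_sq_norm hu']; positivity)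
      exact (this.const_mul (u ^ (s - 1) * Real.exp (-u))).congr
        (ae_of_all _ fun t => (hsplit t u).symm)
    · have h1 : Integrable (fun u => Real.pi ^ m * (u ^ (s - m - 1) * Real.exp (-(1 * u))))
          (volume.restrict (Set.Ioi (0 : ℝ))) :=
        .of_integral_ne_zero (by rw [houter]; positivity)
      refine h1.congr ?_
      filter_upwards [ae_restrict_mem measurableSet_Ioi] with u hu
      rw [← hgauss u hu]
      refine integral_congr_ae (ae_of_all _ fun t => ?_)
      have : 0 < u := hu
      simp only [Function.uncurry_def, hF]
      rw [Real.norm_of_nonneg (by positivity)]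
  have hswap := integral_integral_swap hint
  simp_rw [hinner] at hswap
  rw [integral_mul_const, setIntegral_congr_fun measurableSet_Ioi hgauss, houter] at hswap
  rw [eq_div_iff hG.ne', hswap]

lemma integrable_one_add_norm_sq_rpow {s : ℝ} (hs : (Module.finrank ℝ V : ℝ) / 2 < s) :
    Integrable fun t : V => (1 + ‖t‖ ^ 2) ^ (-s) := by
  have := integrable_rpow_neg_one_add_norm_sq (E := V) (μ := volume) (r := 2 * s) (by linarith)
  simpa [neg_div] using this

lemma integral_one_add_norm_sq_rpow_add_one {s : ℝ} (hs : (Module.finrank ℝ V : ℝ) / 2 < s) :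
    ∫ t : V, (1 + ‖t‖ ^ 2) ^ (-(s + 1)) =
      (1 - (Module.finrank ℝ V : ℝ) / (2 * s)) * ∫ t : V, (1 + ‖t‖ ^ 2) ^ (-s) := by
  have hm0 : 0 ≤ (Module.finrank ℝ V : ℝ) / 2 := by positivity
  have hs0 : 0 < s := hm0.trans_lt hs
  have hG := Real.Gamma_pos_of_pos hs0
  rw [integral_one_add_norm_sq_rpow hs, integral_one_add_norm_sq_rpow (by linarith),
    Real.Gamma_add_one hs0.ne', add_sub_right_comm, Real.Gamma_add_one (sub_pos.2 hs).ne']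
  field_simp

/-- By rotation invariance the second moment of a radial weight is the same in all directions. -/
lemma integral_radial_mul_inner_sq (g : ℝ → ℝ) (hg : Integrable fun t : V => g ‖t‖ * ‖t‖ ^ 2)
    (hgm : AEStronglyMeasurable (fun t : V => g ‖t‖)) (v : V) :
    Module.finrank ℝ V * ∫ t : V, g ‖t‖ * ⟪t, v⟫ ^ 2 =
      ‖v‖ ^ 2 * ∫ t : V, g ‖t‖ * ‖t‖ ^ 2 := by
  set b := stdOrthonormalBasis ℝ V with hb
  have hrot : ∀ w : V, ‖v‖ = ‖w‖ →
      ∫ t : V, g ‖t‖ * ⟪t, v⟫ ^ 2 = ∫ t : V, g ‖t‖ * ⟪t, w⟫ ^ 2 := by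
    intro w hw
    set R := (ℝ ∙ (v - w))ᗮ.reflection
    have hR : R v = w := Submodule.reflection_sub hw
    have h := R.measurePreserving.integral_comp R.toHomeomorph.measurableEmbedding
      (fun t => g ‖t‖ * ⟪t, w⟫ ^ 2)
    rw [← h]
    refine integral_congr_ae (ae_of_all _ fun t => ?_)
    simp only
    rw [R.norm_map, ← hR, R.inner_map_map]
  have hint : ∀ w : V, Integrable fun t : V => g ‖t‖ * ⟪t, w⟫ ^ 2 := by
    intro w
    refine (hg.norm.mul_const (‖w‖ ^ 2)).mono' (hgm.mul (by fun_prop)) (ae_of_all _ fun t => ?_)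
    have := abs_real_inner_le_norm t w
    have h2 : ⟪t, w⟫ ^ 2 ≤ (‖t‖ * ‖w‖) ^ 2 := by
      rw [← sq_abs]; gcongr
    rw [norm_mul, norm_mul, mul_assoc, norm_pow, norm_pow, norm_norm, ← mul_pow,
      Real.norm_eq_abs (⟪t, w⟫)]
    gcongr
  have hi : ∀ i, ∫ t : V, g ‖t‖ * ⟪t, v⟫ ^ 2 = ‖v‖ ^ 2 * ∫ t : V, g ‖t‖ * ⟪t, b i⟫ ^ 2 := by
    intro i
    rw [hrot (‖v‖ • b i) (by rw [norm_smul, norm_norm, b.norm_eq_one, mul_one]),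
      ← integral_const_mul]
    refine integral_congr_ae (ae_of_all _ fun t => ?_)
    simp only
    rw [real_inner_smul_right]
    ring
  have hsum : ∑ i, ∫ t : V, g ‖t‖ * ⟪t, b i⟫ ^ 2 = ∫ t : V, g ‖t‖ * ‖t‖ ^ 2 := by
    rw [← integral_finsetSum _ fun i _ => hint (b i)]
    simp_rw [← Finset.mul_sum, b.sum_sq_inner_left]
  rw [← hsum, Finset.mul_sum, ← Finset.sum_congr rfl fun i _ => hi i, Finset.sum_const,
    Finset.card_univ, Fintype.card_fin, nsmul_eq_mul]

end Japanese

/-! ### The case `p = 2` -/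

section SquareNorm

variable {d : ℕ}

lemma sphereArea_eq {k : ℕ} (hk : 0 < k) :
    sphereArea k = 2 * Real.pi ^ ((k : ℝ) / 2) / Real.Gamma ((k : ℝ) / 2) := by
  have : Nonempty (Fin k) := ⟨⟨0, hk⟩⟩
  have hk' : (0 : ℝ) < k := by exact_mod_cast hk
  have hG := Real.Gamma_pos_of_pos (half_pos hk')
  rw [sphereArea, Measure.toSphere_apply_univ, EuclideanSpace.volume_ball]
  simp only [finrank_euclideanSpace_fin, Fintype.card_fin, ENNReal.ofReal_one, one_pow, one_mul,
    ENNReal.toReal_mul, ENNReal.toReal_natCast]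
  rw [Real.Gamma_add_one (half_pos hk').ne', ENNReal.toReal_ofReal (by positivity),
    Real.sqrt_eq_rpow, ← Real.rpow_natCast, ← Real.rpow_mul Real.pi_pos.le]
  rw [show (1 / 2 : ℝ) * k = k / 2 by ring]
  field_simp

/-- The base integral is `2⁻ⁿ ω_n`, by the duplication formula of the Gamma function. -/
lemma integral_one_add_norm_sq_rpow_dim :
    ∫ t : EuclideanSpace ℝ (Fin d), (1 + ‖t‖ ^ 2) ^ (-((d + 1 : ℕ) : ℝ)) =
      sphereArea (d + 1) / 2 ^ (d + 1) := by
  have hd : (0 : ℝ) ≤ d := Nat.cast_nonneg d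
  rw [integral_one_add_norm_sq_rpow (by rw [finrank_euclideanSpace_fin]; push_cast; linarith),
    finrank_euclideanSpace_fin, sphereArea_eq (Nat.succ_pos d)]
  push_cast
  have h1 := Real.Gamma_mul_Gamma_add_half (((d : ℝ) + 1) / 2)
  have h2 : ((d : ℝ) + 1) / 2 + 1 / 2 = d + 1 - d / 2 := by ring
  have h3 : 2 * (((d : ℝ) + 1) / 2) = d + 1 := by ring
  rw [h2, h3] at h1
  have h4 : (2 : ℝ) ^ (1 - ((d : ℝ) + 1)) * 2 ^ (d + 1) = 2 := by
    rw [← Real.rpow_natCast 2 (d + 1), ← Real.rpow_add two_pos]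
    push_cast
    simp
  have h5 : Real.pi ^ (((d : ℝ) + 1) / 2) = Real.pi ^ ((d : ℝ) / 2) * √Real.pi := by
    rw [Real.sqrt_eq_rpow, ← Real.rpow_add Real.pi_pos]
    congr 1
    ring
  have hG := Real.Gamma_pos_of_pos (by linarith : (0 : ℝ) < d + 1)
  have hG2 := Real.Gamma_pos_of_pos (by linarith : (0 : ℝ) < (d + 1) / 2)
  rw [h5, div_div, div_eq_div_iff hG.ne' (by positivity)]
  linear_combination (Real.pi ^ ((d : ℝ) / 2) * 2 ^ (d + 1)) * h1
    + (Real.pi ^ ((d : ℝ) / 2) * Real.Gamma (d + 1) * √Real.pi) * h4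

/-- The quadratic form `z ↦ ‖profile z‖²` of the case `p = 2`. -/
lemma integral_profile_sq (hd : 1 ≤ d) (z : EuclideanSpace ℝ (Fin (d + 1))) :
    ∫ t, profile z t ^ 2 = sphereArea (d + 1) / 2 ^ (d + 1) * (((d : ℝ) + 1) / 4) *
      (d * z (Fin.last d) ^ 2 + ‖horiz z‖ ^ 2) := by
  have hd' : (1 : ℝ) ≤ d := by exact_mod_cast hd
  set n : ℝ := ((d + 1 : ℕ) : ℝ) with hn
  have hnd : n = d + 1 := by rw [hn]; push_cast; rfl
  set c := z (Fin.last d)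
  set A : EuclideanSpace ℝ (Fin d) → ℝ → ℝ := fun t s => (1 + ‖t‖ ^ 2) ^ (-s) with hA
  have hApos : ∀ t : EuclideanSpace ℝ (Fin d), (0 : ℝ) < 1 + ‖t‖ ^ 2 := fun t => by positivity
  have hfr : (Module.finrank ℝ (EuclideanSpace ℝ (Fin d)) : ℝ) = d := by simp
  have hint : ∀ s : ℝ, n ≤ s → Integrable (fun t => A t s) := fun s hs =>
    integrable_one_add_norm_sq_rpow (by rw [hfr]; linarith)
  have hW0 : ∫ t, A t n = sphereArea (d + 1) / 2 ^ (d + 1) := integral_one_add_norm_sq_rpow_dim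
  have hW1 : ∫ t, A t (n + 1) = (1 - d / (2 * n)) * ∫ t, A t n := by
    have := integral_one_add_norm_sq_rpow_add_one (V := EuclideanSpace ℝ (Fin d)) (s := n)
      (by rw [hfr]; linarith)
    rwa [hfr] at this
  have hW2 : ∫ t, A t (n + 1 + 1) = (1 - d / (2 * (n + 1))) * ∫ t, A t (n + 1) := by
    have := integral_one_add_norm_sq_rpow_add_one (V := EuclideanSpace ℝ (Fin d)) (s := n + 1)
      (by rw [hfr]; linarith)
    rwa [hfr] at this
  have hrad : ∀ t, A t (n + 1 + 1) * ‖t‖ ^ 2 = A t (n + 1) - A t (n + 1 + 1) := fun t => by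
    have : A t (n + 1) = A t (n + 1 + 1) * (1 + ‖t‖ ^ 2) := by
      rw [hA]
      simp only
      rw [← Real.rpow_add_one (hApos t).ne']
      congr 1
      ring
    rw [this]
    ring
  have hradint : Integrable fun t => A t (n + 1 + 1) * ‖t‖ ^ 2 := by
    simp_rw [hrad]
    exact (hint _ (by linarith)).sub (hint _ (by linarith))
  have htan := integral_radial_mul_inner_sq (V := EuclideanSpace ℝ (Fin d))
    (fun r => (1 + r ^ 2) ^ (-(n + 1 + 1))) hradint (hint _ (by linarith)).1 (horiz z)
  have htanint : Integrable fun t => A t (n + 1 + 1) * ⟪t, horiz z⟫ ^ 2 := by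
    refine (hradint.mul_const (‖horiz z‖ ^ 2)).mono'
      ((hint _ (by linarith)).1.mul (by fun_prop)) (ae_of_all _ fun t => ?_)
    have h2 : ⟪t, horiz z⟫ ^ 2 ≤ (‖t‖ * ‖horiz z‖) ^ 2 := by
      rw [← sq_abs]
      gcongr
      exact abs_real_inner_le_norm t (horiz z)
    have h3 : 0 ≤ A t (n + 1 + 1) := by rw [hA]; positivity
    rw [Real.norm_of_nonneg (by positivity), mul_assoc, ← mul_pow]
    gcongr
  -- the terms odd in `t` cancel after symmetrization
  have hsym : ∀ t, profile z t ^ 2 + profile z (-t) ^ 2 = 2 * (c ^ 2 *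
      (A t n - 2 * n * A t (n + 1) + n ^ 2 * A t (n + 1 + 1)) +
      n ^ 2 * (A t (n + 1 + 1) * ⟪t, horiz z⟫ ^ 2)) := fun t => by
    rw [profile_eq, profile_eq, norm_neg, inner_neg_left, ← hn]
    have h1 : ∀ a b : ℝ, (1 + ‖t‖ ^ 2) ^ a * (1 + ‖t‖ ^ 2) ^ b = A t (-(a + b)) := fun a b => by
      rw [hA, ← Real.rpow_add (hApos t)]
      simp
    have e0 := h1 (-n / 2) (-n / 2)
    have e1 := h1 (-n / 2) (-n / 2 - 1)
    have e2 := h1 (-n / 2 - 1) (-n / 2 - 1)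
    rw [show -(-n / 2 + -n / 2) = n by ring] at e0
    rw [show -(-n / 2 + (-n / 2 - 1)) = n + 1 by ring] at e1
    rw [show -(-n / 2 - 1 + (-n / 2 - 1)) = n + 1 + 1 by ring] at e2
    rw [← e0, ← e1, ← e2]
    ring
  have hp2 : Integrable fun t => profile z t ^ 2 := by
    have := integrable_abs_profile_rpow z (q := 2) (by norm_num)
    simpa [sq_abs] using this
  have h1 : ∫ t, profile z t ^ 2 = ∫ t, (c ^ 2 *
      (A t n - 2 * n * A t (n + 1) + n ^ 2 * A t (n + 1 + 1)) +
      n ^ 2 * (A t (n + 1 + 1) * ⟪t, horiz z⟫ ^ 2)) := by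
    have h2 := integral_neg_eq_self (fun t => profile z t ^ 2) volume
    have h3 := integral_add hp2 hp2.comp_neg
    simp_rw [hsym] at h3
    rw [integral_const_mul, h2] at h3
    linarith
  have i0 := hint n le_rfl
  have i1 := (hint (n + 1) (by linarith)).const_mul (2 * n)
  have i2 := (hint (n + 1 + 1) (by linarith)).const_mul (n ^ 2)
  have i01 : Integrable fun t => A t n - 2 * n * A t (n + 1) := i0.sub i1
  have i012 : Integrable fun t => A t n - 2 * n * A t (n + 1) + n ^ 2 * A t (n + 1 + 1) :=
    i01.add i2
  rw [h1, integral_add (i012.const_mul _) (htanint.const_mul _), integral_const_mul,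
    integral_const_mul, integral_add i01 i2, integral_sub i0 i1, integral_const_mul,
    integral_const_mul]
  have htan' : (d : ℝ) * ∫ t, A t (n + 1 + 1) * ⟪t, horiz z⟫ ^ 2 =
      ‖horiz z‖ ^ 2 * ((∫ t, A t (n + 1)) - ∫ t, A t (n + 1 + 1)) := by
    rw [← integral_sub (hint _ (by linarith)) (hint _ (by linarith))]
    simp_rw [← hrad]
    rw [← htan, hfr]
  have htan'' : ∫ t, A t (n + 1 + 1) * ⟪t, horiz z⟫ ^ 2 =
      ‖horiz z‖ ^ 2 * ((∫ t, A t (n + 1)) - ∫ t, A t (n + 1 + 1)) / d := by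
    rw [← htan']
    field_simp
  rw [htan'', hW2, hW1, hW0, hnd]
  field_simp
  ring

lemma dirNorm_two (hd : 1 ≤ d) (z : EuclideanSpace ℝ (Fin (d + 1))) :
    dirNorm 2 z = √(sphereArea (d + 1) / 2 ^ (d + 1) * (((d : ℝ) + 1) / 4) *
      (d * z (Fin.last d) ^ 2 + ‖horiz z‖ ^ 2)) := by
  rw [← integral_profile_sq hd, dirNorm, Real.sqrt_eq_rpow]
  simp [sq_abs]

/-- For `p = 2` the normal direction is extremal. -/
lemma iSup_dirNorm_two (hd : 1 ≤ d) :
    ⨆ z : Metric.sphere (0 : EuclideanSpace ℝ (Fin (d + 1))) 1, dirNorm 2 z.1 =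
      dirNorm 2 (normalVec d) := by
  have hd' : (1 : ℝ) ≤ d := by exact_mod_cast hd
  have hω := sphereArea_pos (Nat.succ_pos d)
  have : Nonempty (Metric.sphere (0 : EuclideanSpace ℝ (Fin (d + 1))) 1) :=
    ⟨⟨normalVec d, by simp [norm_normalVec]⟩⟩
  refine le_antisymm (ciSup_le fun z => ?_) (le_ciSup
    (bddAbove_dirNorm (d := d) (q := 2) (by norm_num)) ⟨normalVec d, by simp [norm_normalVec]⟩)
  rw [dirNorm_two hd, dirNorm_two hd, normalVec_last, horiz_normalVec]
  have h1 : ‖horiz z.1‖ ^ 2 + z.1 (Fin.last d) ^ 2 = 1 := by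
    rw [← norm_sq_eq_horiz, norm_eq_of_mem_sphere z, one_pow]
  refine Real.sqrt_le_sqrt (mul_le_mul_of_nonneg_left ?_ (by positivity))
  rw [norm_zero]
  nlinarith [sq_nonneg ‖horiz z.1‖]

lemma sharp_two_eq (hd : 1 ≤ d) :
    2 / sphereArea (d + 1) * dirNorm 2 (normalVec d) =
      √(((d + 1 : ℕ) : ℝ) * (((d + 1 : ℕ) : ℝ) - 1) / (2 ^ (d + 1) * sphereArea (d + 1))) := by
  have hω := sphereArea_pos (Nat.succ_pos d)
  rw [dirNorm_two hd, normalVec_last, horiz_normalVec,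
    ← Real.sqrt_sq (by positivity : 0 ≤ 2 / sphereArea (d + 1)), ← Real.sqrt_mul (sq_nonneg _)]
  congr 1
  push_cast
  rw [norm_zero]
  field_simp
  ring

end SquareNorm

/-! ### Spherical coordinates about an axis -/

section Polar

lemma lintegral_fun_norm {k : ℕ} (hk : 0 < k) {g : ℝ → ENNReal} (hg : Measurable g) :
    ∫⁻ y : EuclideanSpace ℝ (Fin k), g ‖y‖ =
      ENNReal.ofReal (sphereArea k) *
        ∫⁻ r in Set.Ioi (0 : ℝ), ENNReal.ofReal (r ^ (k - 1)) * g r := by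
  have : Nonempty (Fin k) := ⟨⟨0, hk⟩⟩
  have : Nontrivial (EuclideanSpace ℝ (Fin k)) := Module.nontrivial_of_finrank_pos (R := ℝ)
    (by simpa using hk)
  have hmp :=
    (volume : Measure (EuclideanSpace ℝ (Fin k))).measurePreserving_homeomorphUnitSphereProd
  have h1 := hmp.lintegral_comp (f := fun p => g p.2.1) (by fun_prop)
  simp only [homeomorphUnitSphereProd_apply_snd_coe] at h1
  rw [← restrict_compl_singleton (μ := volume) (0 : EuclideanSpace ℝ (Fin k)),
    ← lintegral_subtype_comap (measurableSet_singleton _).compl, h1,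
    lintegral_prod _ (by fun_prop)]
  simp only [lintegral_const, finrank_euclideanSpace_fin]
  rw [sphereArea, ENNReal.ofReal_toReal (measure_ne_top _ _), mul_comm]
  congr 1
  rw [Measure.volumeIoiPow, lintegral_withDensity_eq_lintegral_mul _ (by fun_prop) (by fun_prop),
    ← lintegral_subtype_comap measurableSet_Ioi]
  rfl

lemma lintegral_euclidean_succ {k : ℕ} {g : ℝ → ℝ → ENNReal}
    (hg : Measurable (Function.uncurry g)) :
    ∫⁻ t : EuclideanSpace ℝ (Fin (k + 1)), g ‖t‖ (t 0) =
      ∫⁻ a : ℝ, ∫⁻ y : EuclideanSpace ℝ (Fin k), g (√(a ^ 2 + ‖y‖ ^ 2)) a := by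
  have h1 := (PiLp.volume_preserving_toLp (Fin (k + 1))).lintegral_comp_emb
    (MeasurableEquiv.toLp 2 (Fin (k + 1) → ℝ)).measurableEmbedding (fun t => g ‖t‖ (t 0))
  have h2 := (volume_preserving_piFinSuccAbove (fun _ : Fin (k + 1) => ℝ) 0).symm.lintegral_comp_emb
    (MeasurableEquiv.measurableEmbedding _)
    (fun s : Fin (k + 1) → ℝ => g ‖(WithLp.toLp 2 s : EuclideanSpace ℝ (Fin (k + 1)))‖ (s 0))
  rw [← h1]
  simp only
  rw [← h2]
  have hnorm : ∀ (a : ℝ) (s : Fin k → ℝ),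
      ‖(WithLp.toLp 2 ((MeasurableEquiv.piFinSuccAbove (fun _ : Fin (k + 1) => ℝ) 0).symm (a, s)) :
        EuclideanSpace ℝ (Fin (k + 1)))‖ =
      √(a ^ 2 + ‖(WithLp.toLp 2 s : EuclideanSpace ℝ (Fin k))‖ ^ 2) := by
    intro a s
    rw [EuclideanSpace.norm_eq, EuclideanSpace.norm_sq_eq, Fin.sum_univ_succ]
    simp [MeasurableEquiv.piFinSuccAbove]
  have hmeas : Measurable fun p : ℝ × (Fin k → ℝ) =>
      g (√(p.1 ^ 2 + ‖(WithLp.toLp 2 p.2 : EuclideanSpace ℝ (Fin k))‖ ^ 2)) p.1 := by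
    have : Measurable fun p : ℝ × (Fin k → ℝ) =>
        (√(p.1 ^ 2 + ‖(WithLp.toLp 2 p.2 : EuclideanSpace ℝ (Fin k))‖ ^ 2), p.1) := by fun_prop
    exact hg.comp this
  calc _ = ∫⁻ p : ℝ × (Fin k → ℝ),
        g (√(p.1 ^ 2 + ‖(WithLp.toLp 2 p.2 : EuclideanSpace ℝ (Fin k))‖ ^ 2)) p.1 := by
        refine lintegral_congr fun p => ?_
        rw [show p = (p.1, p.2) from rfl, hnorm]
        simp [MeasurableEquiv.piFinSuccAbove]
    _ = ∫⁻ a : ℝ, ∫⁻ s : Fin k → ℝ,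
        g (√(a ^ 2 + ‖(WithLp.toLp 2 s : EuclideanSpace ℝ (Fin k))‖ ^ 2)) a := by
        rw [Measure.volume_eq_prod, lintegral_prod _ hmeas.aemeasurable]
    _ = _ := by
        refine lintegral_congr fun a => ?_
        exact (PiLp.volume_preserving_toLp (Fin k)).lintegral_comp_emb
          (MeasurableEquiv.toLp 2 (Fin k → ℝ)).measurableEmbedding
          (fun y => g (√(a ^ 2 + ‖y‖ ^ 2)) a)

/-- Integration over a half-plane in polar coordinates. -/
lemma lintegral_halfPlane_polar {H : ℝ → ℝ → ENNReal} (hH : Measurable (Function.uncurry H)) :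
    ∫⁻ a : ℝ, ∫⁻ ρ in Set.Ioi (0 : ℝ), H a ρ =
      ∫⁻ φ in Set.Ioo 0 Real.pi, ∫⁻ r in Set.Ioi (0 : ℝ),
        ENNReal.ofReal r * H (r * Real.cos φ) (r * Real.sin φ) := by
  set S : Set (ℝ × ℝ) := Set.univ ×ˢ Set.Ioi 0 with hS
  have hSm : MeasurableSet S := MeasurableSet.univ.prod measurableSet_Ioi
  have hT : MeasurableSet (Set.Ioi (0 : ℝ) ×ˢ Set.Ioo 0 Real.pi) :=
    measurableSet_Ioi.prod measurableSet_Ioo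
  have h1 := lintegral_comp_polarCoord_symm (S.indicator (Function.uncurry H))
  have h2 : ∫⁻ p, S.indicator (Function.uncurry H) p =
      ∫⁻ a : ℝ, ∫⁻ ρ in Set.Ioi (0 : ℝ), H a ρ := by
    rw [lintegral_indicator hSm, hS, Measure.volume_eq_prod, ← Measure.prod_restrict,
      lintegral_prod _ hH.aemeasurable]
    simp
  rw [← h2, ← h1]
  have h3 : ∀ p ∈ polarCoord.target, ENNReal.ofReal p.1 •
      S.indicator (Function.uncurry H) (polarCoord.symm p) =
      (Set.Ioi (0 : ℝ) ×ˢ Set.Ioo 0 Real.pi).indicator (fun p : ℝ × ℝ =>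
        ENNReal.ofReal p.1 * H (p.1 * Real.cos p.2) (p.1 * Real.sin p.2)) p := by
    rintro ⟨r, φ⟩ ⟨hr, hφ⟩
    have hr' : 0 < r := hr
    have hφ1 : -Real.pi < φ := hφ.1
    have hφ2 : φ < Real.pi := hφ.2
    rw [polarCoord_symm_apply, smul_eq_mul]
    by_cases h : 0 < φ
    · have hs : 0 < r * Real.sin φ := mul_pos hr' (Real.sin_pos_of_pos_of_lt_pi h hφ2)
      rw [Set.indicator_of_mem (by exact ⟨trivial, hs⟩),
        Set.indicator_of_mem (by exact ⟨hr, h, hφ2⟩)]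
      rfl
    · have hs : Real.sin φ ≤ 0 := Real.sin_nonpos_of_nonpos_of_neg_pi_le (not_lt.1 h) hφ1.le
      rw [Set.indicator_of_notMem, Set.indicator_of_notMem, mul_zero]
      · rintro ⟨-, h', -⟩
        exact h h'
      · rintro ⟨-, h'⟩
        have h'' : 0 < r * Real.sin φ := h'
        nlinarith
  have hsub : Set.Ioi (0 : ℝ) ×ˢ Set.Ioo 0 Real.pi ⊆ polarCoord.target := by
    rintro ⟨r, φ⟩ ⟨hr, hφ⟩
    exact ⟨hr, by linarith [hφ.1, Real.pi_pos], hφ.2⟩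
  have hm : Measurable fun p : ℝ × ℝ =>
      ENNReal.ofReal p.1 * H (p.1 * Real.cos p.2) (p.1 * Real.sin p.2) := by
    have : Measurable fun p : ℝ × ℝ => (p.1 * Real.cos p.2, p.1 * Real.sin p.2) := by fun_prop
    exact (by fun_prop : Measurable fun p : ℝ × ℝ => ENNReal.ofReal p.1).mul (hH.comp this)
  rw [setLIntegral_congr_fun polarCoord.open_target.measurableSet h3, lintegral_indicator hT,
    Measure.restrict_restrict hT, Set.inter_eq_left.2 hsub, Measure.volume_eq_prod,
    ← Measure.prod_restrict, lintegral_prod_symm _ hm.aemeasurable]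

/-- Spherical coordinates about the axis spanned by a unit vector `v`: `r` is the distance to the
origin and `φ` the angle with `v`. -/
lemma lintegral_spherical {k : ℕ} (hk : 0 < k) {g : ℝ → ℝ → ENNReal}
    (hg : Measurable (Function.uncurry g)) {v : EuclideanSpace ℝ (Fin (k + 1))} (hv : ‖v‖ = 1) :
    ∫⁻ t, g ‖t‖ ⟪t, v⟫ = ENNReal.ofReal (sphereArea k) *
      ∫⁻ φ in Set.Ioo 0 Real.pi, ∫⁻ r in Set.Ioi (0 : ℝ),
        ENNReal.ofReal (r ^ k * Real.sin φ ^ (k - 1)) * g r (r * Real.cos φ) := by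
  set w : EuclideanSpace ℝ (Fin (k + 1)) := EuclideanSpace.single 0 (1 : ℝ) with hw
  set R := (ℝ ∙ (v - w))ᗮ.reflection
  have hR : R v = w := Submodule.reflection_sub (by simp [hv, hw])
  have h1 := R.measurePreserving.lintegral_comp_emb R.toHomeomorph.measurableEmbedding
    (fun t => g ‖t‖ (t 0))
  have h2 : ∀ t, g ‖R t‖ (R t 0) = g ‖t‖ ⟪t, v⟫ := fun t => by
    rw [R.norm_map, ← R.inner_map_map t v, hR, hw, real_inner_comm,
      EuclideanSpace.inner_single_left]
    simp
  simp_rw [h2] at h1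
  have hm1 : ∀ a : ℝ, Measurable fun ρ : ℝ => g (√(a ^ 2 + ρ ^ 2)) a := fun a => by
    have : Measurable fun ρ : ℝ => (√(a ^ 2 + ρ ^ 2), a) := by fun_prop
    exact hg.comp this
  have hm2 : Measurable (Function.uncurry fun a ρ : ℝ =>
      ENNReal.ofReal (ρ ^ (k - 1)) * g (√(a ^ 2 + ρ ^ 2)) a) := by
    have : Measurable fun p : ℝ × ℝ => (√(p.1 ^ 2 + p.2 ^ 2), p.1) := by fun_prop
    exact (by fun_prop : Measurable fun p : ℝ × ℝ => ENNReal.ofReal (p.2 ^ (k - 1))).mul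
      (hg.comp this)
  rw [h1, lintegral_euclidean_succ hg]
  simp_rw [fun a : ℝ => lintegral_fun_norm hk (hm1 a)]
  rw [lintegral_const_mul' _ _ ENNReal.ofReal_ne_top, lintegral_halfPlane_polar hm2]
  congr 1
  refine setLIntegral_congr_fun measurableSet_Ioo fun φ hφ => ?_
  refine setLIntegral_congr_fun measurableSet_Ioi fun r hr => ?_
  have hr' : 0 < r := hr
  have hs : 0 < Real.sin φ := Real.sin_pos_of_mem_Ioo hφ
  have h3 : √((r * Real.cos φ) ^ 2 + (r * Real.sin φ) ^ 2) = r := by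
    rw [mul_pow, mul_pow, ← mul_add, Real.cos_sq_add_sin_sq, mul_one, Real.sqrt_sq hr'.le]
  rw [h3, ← mul_assoc, ← ENNReal.ofReal_mul hr'.le]
  congr 2
  obtain ⟨j, rfl⟩ : ∃ j, k = j + 1 := ⟨k - 1, by omega⟩
  rw [Nat.add_sub_cancel]
  ring

lemma lintegral_Ioi_eq_tan (h : ℝ → ENNReal) :
    ∫⁻ r in Set.Ioi (0 : ℝ), h r =
      ∫⁻ θ in Set.Ioo 0 (Real.pi / 2), ENNReal.ofReal (1 / Real.cos θ ^ 2) * h (Real.tan θ) := by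
  have hcos : ∀ θ ∈ Set.Ioo 0 (Real.pi / 2), 0 < Real.cos θ := fun θ hθ =>
    Real.cos_pos_of_mem_Ioo ⟨by linarith [hθ.1, Real.pi_pos], hθ.2⟩
  have himg : Real.tan '' Set.Ioo 0 (Real.pi / 2) = Set.Ioi 0 := by
    ext r
    constructor
    · rintro ⟨θ, hθ, rfl⟩
      exact Real.tan_pos_of_pos_of_lt_pi_div_two hθ.1 hθ.2
    · intro hr
      exact ⟨Real.arctan r, ⟨Real.arctan_pos.2 hr, Real.arctan_lt_pi_div_two r⟩, Real.tan_arctan r⟩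
  have hinj : Set.InjOn Real.tan (Set.Ioo 0 (Real.pi / 2)) :=
    Real.injOn_tan.mono (Set.Ioo_subset_Ioo_left (by linarith [Real.pi_pos]))
  rw [← himg, lintegral_image_eq_lintegral_abs_deriv_mul measurableSet_Ioo
    (fun θ hθ => (Real.hasDerivAt_tan (hcos θ hθ).ne').hasDerivWithinAt) hinj]
  refine setLIntegral_congr_fun measurableSet_Ioo fun θ hθ => ?_
  rw [abs_of_pos (by have := hcos θ hθ; positivity)]

lemma lintegral_lintegral_ofReal_eq {K : ℝ → ℝ → ℝ} (hK : Continuous (Function.uncurry K))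
    {a b : ℝ} (ha : 0 ≤ a) (hb : 0 ≤ b)
    (h0 : ∀ φ ∈ Set.Ioo 0 a, ∀ θ ∈ Set.Ioo 0 b, 0 ≤ K φ θ) :
    ∫⁻ φ in Set.Ioo 0 a, ∫⁻ θ in Set.Ioo 0 b, ENNReal.ofReal (K φ θ) =
      ENNReal.ofReal (∫ φ in (0 : ℝ)..a, ∫ θ in (0 : ℝ)..b, K φ θ) := by
  have hin : ∀ φ, ∫ θ in (0 : ℝ)..b, K φ θ = ∫ θ in Set.Ioo 0 b, K φ θ := fun φ => by
    rw [intervalIntegral.integral_of_le hb, integral_Ioc_eq_integral_Ioo]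
  have hcont : Continuous fun φ => ∫ θ in (0 : ℝ)..b, K φ θ :=
    intervalIntegral.continuous_parametric_intervalIntegral_of_continuous' hK 0 b
  have h1 : ∀ φ ∈ Set.Ioo 0 a, ∫⁻ θ in Set.Ioo 0 b, ENNReal.ofReal (K φ θ) =
      ENNReal.ofReal (∫ θ in (0 : ℝ)..b, K φ θ) := fun φ hφ => by
    have hc : Continuous (K φ) := hK.comp (by fun_prop : Continuous fun θ => (φ, θ))
    rw [hin, ofReal_integral_eq_lintegral_ofReal
      ((hc.integrableOn_Icc (a := 0) (b := b)).mono_set Set.Ioo_subset_Icc_self)]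
    filter_upwards [ae_restrict_mem measurableSet_Ioo] with θ hθ
    exact h0 φ hφ θ hθ
  rw [setLIntegral_congr_fun measurableSet_Ioo h1, intervalIntegral.integral_of_le ha,
    integral_Ioc_eq_integral_Ioo, ofReal_integral_eq_lintegral_ofReal
      ((hcont.integrableOn_Icc (a := 0) (b := a)).mono_set Set.Ioo_subset_Icc_self)]
  filter_upwards [ae_restrict_mem measurableSet_Ioo] with φ hφ
  rw [hin]
  exact setIntegral_nonneg measurableSet_Ioo fun θ hθ => h0 φ hφ θ hθ

end Polar

/-! ### The formula for the sharp constant in dimension at least three -/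

section Formula

lemma continuous_integrand {p : ℝ} (hp : 1 < p) (n : ℕ) (γ : ℝ) :
    Continuous (Function.uncurry (integrand n p γ)) := by
  have hp' : 0 < p - 1 := by linarith
  unfold integrand
  refine ((Continuous.mul ?_ ?_).mul ?_).mul ?_
  · exact Continuous.rpow_const (by fun_prop) fun _ => Or.inr (by positivity)
  · exact Continuous.rpow_const (by fun_prop) fun _ => Or.inr (by positivity)
  · fun_prop
  · fun_prop

lemma integrand_nonneg (n : ℕ) (p γ : ℝ) {φ θ : ℝ} (hφ : φ ∈ Set.Ioo 0 Real.pi)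
    (hθ : θ ∈ Set.Ioo 0 (Real.pi / 2)) : 0 ≤ integrand n p γ φ θ := by
  have h1 : 0 < Real.sin φ := Real.sin_pos_of_mem_Ioo hφ
  have h2 : 0 < Real.cos θ := Real.cos_pos_of_mem_Ioo ⟨by linarith [hθ.1, Real.pi_pos], hθ.2⟩
  have h3 : 0 < Real.sin θ := Real.sin_pos_of_mem_Ioo ⟨hθ.1, by linarith [hθ.2, Real.pi_pos]⟩
  unfold integrand
  positivity

lemma integral_integrand_nonneg (n : ℕ) (p γ : ℝ) :
    0 ≤ ∫ φ in (0 : ℝ)..Real.pi, ∫ θ in (0 : ℝ)..(Real.pi / 2), integrand n p γ φ θ := by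
  rw [intervalIntegral.integral_of_le Real.pi_pos.le, integral_Ioc_eq_integral_Ioo]
  refine setIntegral_nonneg measurableSet_Ioo fun φ hφ => ?_
  rw [intervalIntegral.integral_of_le Real.pi_div_two_pos.le, integral_Ioc_eq_integral_Ioo]
  exact setIntegral_nonneg measurableSet_Ioo fun θ hθ => integrand_nonneg n p γ hφ hθ

/-- The substitution `r = tan θ` turns the spherical form of `|profile z|^q` into the integrand. -/
lemma jacobian_mul_profile_rpow_eq_integrand {k : ℕ} {p q : ℝ} (hpq : p.HolderConjugate q)
    {c κ φ θ : ℝ} (hc : 0 < c) (hθ : θ ∈ Set.Ioo 0 (Real.pi / 2)) :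
    1 / Real.cos θ ^ 2 * (Real.tan θ ^ k * Real.sin φ ^ (k - 1) *
      |(1 + Real.tan θ ^ 2) ^ (-((k + 1 + 1 : ℕ) : ℝ) / 2) * c - ((k + 1 + 1 : ℕ) : ℝ) *
        (1 + Real.tan θ ^ 2) ^ (-((k + 1 + 1 : ℕ) : ℝ) / 2 - 1) *
          (c + κ * (Real.tan θ * Real.cos φ))| ^ q) =
      c ^ q * integrand (k + 1 + 1) p (κ / c) φ θ := by
  have hC : 0 < Real.cos θ := Real.cos_pos_of_mem_Ioo ⟨by linarith [hθ.1, Real.pi_pos], hθ.2⟩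
  have hp1 : 0 < p - 1 := by linarith [hpq.lt]
  have hq : q = p / (p - 1) := hpq.conjugate_eq
  set n : ℕ := k + 1 + 1 with hn
  set C := Real.cos θ with hCdef
  have h1 : 1 + Real.tan θ ^ 2 = (C ^ 2)⁻¹ := by
    rw [Real.tan_eq_sin_div_cos, ← hCdef]
    field_simp
    linarith [Real.sin_sq_add_cos_sq θ]
  have hpow : ∀ s : ℝ, ((C ^ 2)⁻¹) ^ s = C ^ (-(2 * s)) := fun s => by
    rw [← Real.rpow_natCast C 2, ← Real.rpow_neg hC.le, ← Real.rpow_mul hC.le]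
    congr 1
    push_cast
    ring
  have h2 : ((C ^ 2)⁻¹) ^ (-(n : ℝ) / 2) = C ^ n := by
    rw [hpow, ← Real.rpow_natCast C n]
    congr 1
    ring
  have h3 : ((C ^ 2)⁻¹) ^ (-(n : ℝ) / 2 - 1) = C ^ n * C ^ 2 := by
    rw [hpow, ← pow_add, ← Real.rpow_natCast C (n + 2)]
    congr 1
    push_cast
    ring
  have h4 : C ^ n * c - n * (C ^ n * C ^ 2) * (c + κ * (Real.tan θ * Real.cos φ)) =
      -((C ^ n * c) * (((n : ℝ) * C ^ 2 - 1) + n * (κ / c) * C * Real.sin θ * Real.cos φ)) := by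
    rw [Real.tan_eq_sin_div_cos, ← hCdef]
    field_simp
    ring
  have h5 : (C ^ n) ^ q = C ^ ((n : ℝ) / (p - 1)) * C ^ n := by
    rw [← Real.rpow_natCast C n, ← Real.rpow_mul hC.le, ← Real.rpow_add hC, hq]
    congr 1
    field_simp
    ring
  rw [h1, h2, h3, h4, abs_neg, abs_mul, abs_of_pos (by positivity),
    Real.mul_rpow (by positivity) (abs_nonneg _), Real.mul_rpow (by positivity) hc.le, h5,
    integrand, ← hCdef, ← hq, show n - 2 = k by omega, show n - 3 = k - 1 by omega,
    Real.tan_eq_sin_div_cos, ← hCdef, div_pow]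
  have h6 : C ^ n = C ^ k * C ^ 2 := by rw [← pow_add]
  rw [h6]
  field_simp

variable {k : ℕ} {p q : ℝ}

lemma integral_abs_profile_rpow (hk : 0 < k) (hpq : p.HolderConjugate q)
    {z : EuclideanSpace ℝ (Fin (k + 1 + 1))} (hz : 0 < z (Fin.last (k + 1))) :
    ∫ t, |profile z t| ^ q = sphereArea k * (z (Fin.last (k + 1)) ^ q *
      ∫ φ in (0 : ℝ)..Real.pi, ∫ θ in (0 : ℝ)..(Real.pi / 2),
        integrand (k + 1 + 1) p (‖horiz z‖ / z (Fin.last (k + 1))) φ θ) := by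
  set c := z (Fin.last (k + 1)) with hc
  set κ := ‖horiz z‖ with hκ
  obtain ⟨v, hv, hzv⟩ : ∃ v : EuclideanSpace ℝ (Fin (k + 1)), ‖v‖ = 1 ∧ horiz z = -(κ • v) := by
    by_cases h0 : horiz z = 0
    · exact ⟨EuclideanSpace.single 0 (1 : ℝ), by simp, by simp [hκ, h0]⟩
    · have hκ0 : 0 < κ := norm_pos_iff.2 h0
      refine ⟨-(κ⁻¹ • horiz z), ?_, ?_⟩
      · rw [norm_neg, norm_smul, norm_inv, Real.norm_of_nonneg hκ0.le, ← hκ,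
          inv_mul_cancel₀ hκ0.ne']
      · rw [smul_neg, neg_neg, smul_inv_smul₀ hκ0.ne']
  set g : ℝ → ℝ → ENNReal := fun r a => ENNReal.ofReal
    (|(1 + r ^ 2) ^ (-((k + 1 + 1 : ℕ) : ℝ) / 2) * c - ((k + 1 + 1 : ℕ) : ℝ) *
        (1 + r ^ 2) ^ (-((k + 1 + 1 : ℕ) : ℝ) / 2 - 1) * (c + κ * a)| ^ q) with hg
  have hgm : Measurable (Function.uncurry g) := by
    simp only [hg, Function.uncurry_def]
    fun_prop
  have h1 : ∀ t, ENNReal.ofReal (|profile z t| ^ q) = g ‖t‖ ⟪t, v⟫ := fun t => by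
    rw [profile_eq, hzv, inner_neg_right, real_inner_smul_right, sub_neg_eq_add]
  have hωpos := sphereArea_pos hk
  rw [integral_eq_lintegral_of_nonneg_ae (ae_of_all _ fun t => by positivity)
    (integrable_abs_profile_rpow z hpq.symm.lt.le).1]
  simp_rw [h1]
  rw [lintegral_spherical hk hgm hv]
  have h2 : ∀ φ ∈ Set.Ioo 0 Real.pi, ∫⁻ r in Set.Ioi (0 : ℝ),
      ENNReal.ofReal (r ^ k * Real.sin φ ^ (k - 1)) * g r (r * Real.cos φ) =
      ∫⁻ θ in Set.Ioo 0 (Real.pi / 2),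
        ENNReal.ofReal (c ^ q * integrand (k + 1 + 1) p (κ / c) φ θ) := by
    intro φ hφ
    rw [lintegral_Ioi_eq_tan]
    refine setLIntegral_congr_fun measurableSet_Ioo fun θ hθ => ?_
    have hs : 0 < Real.sin φ := Real.sin_pos_of_mem_Ioo hφ
    have ht : 0 < Real.tan θ := Real.tan_pos_of_pos_of_lt_pi_div_two hθ.1 hθ.2
    rw [← jacobian_mul_profile_rpow_eq_integrand hpq hz hθ, hg,
      ← ENNReal.ofReal_mul (by positivity), ← ENNReal.ofReal_mul (by positivity)]
  have hcont : Continuous (Function.uncurry fun φ θ =>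
      c ^ q * integrand (k + 1 + 1) p (κ / c) φ θ) :=
    continuous_const.mul (continuous_integrand hpq.lt _ _)
  rw [setLIntegral_congr_fun measurableSet_Ioo h2, lintegral_lintegral_ofReal_eq hcont
    Real.pi_pos.le Real.pi_div_two_pos.le fun φ hφ θ hθ =>
      mul_nonneg (by positivity) (integrand_nonneg _ _ _ hφ hθ)]
  simp only [intervalIntegral.integral_const_mul]
  rw [← ENNReal.ofReal_mul hωpos.le, ENNReal.toReal_ofReal]
  have := integral_integrand_nonneg (k + 1 + 1) p (κ / c)
  positivity

/-- For `z` pointing upwards, `γ` is the ratio of the horizontal to the vertical component. -/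
lemma dirNorm_eq_functional (hk : 0 < k) (hpq : p.HolderConjugate q)
    {z : EuclideanSpace ℝ (Fin (k + 1 + 1))} (hz : 0 < z (Fin.last (k + 1))) :
    dirNorm q z = sphereArea k ^ ((p - 1) / p) *
      (‖z‖ * functional (k + 1 + 1) p (‖horiz z‖ / z (Fin.last (k + 1)))) := by
  have hωpos := sphereArea_pos hk
  have hq0 : 0 < q := hpq.symm.pos
  have hq : (p - 1) / p = 1 / q := by
    rw [hpq.conjugate_eq, one_div_div]
  have hI := integral_integrand_nonneg (k + 1 + 1) p (‖horiz z‖ / z (Fin.last (k + 1)))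
  have hnorm : ‖z‖ = z (Fin.last (k + 1)) *
      √(1 + (‖horiz z‖ / z (Fin.last (k + 1))) ^ 2) := by
    have : z (Fin.last (k + 1)) = √(z (Fin.last (k + 1)) ^ 2) := (Real.sqrt_sq hz.le).symm
    nth_rewrite 1 [this]
    rw [← Real.sqrt_mul (sq_nonneg _), ← Real.sqrt_sq (norm_nonneg z), norm_sq_eq_horiz]
    congr 1
    field_simp
    ring
  rw [dirNorm, integral_abs_profile_rpow hk hpq hz, functional, hq,
    Real.mul_rpow hωpos.le (by positivity), Real.mul_rpow (by positivity) hI,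
    ← Real.rpow_mul hz.le, mul_one_div_cancel hq0.ne', Real.rpow_one, hnorm]
  have : √(1 + (‖horiz z‖ / z (Fin.last (k + 1))) ^ 2) ≠ 0 := by positivity
  field_simp

lemma dirNorm_neg {d : ℕ} (q : ℝ) (z : EuclideanSpace ℝ (Fin (d + 1))) :
    dirNorm q (-z) = dirNorm q z := by
  simp [dirNorm, profile]

lemma dirNorm_add_le {d : ℕ} {q : ℝ} (hq : 1 ≤ q) (z w : EuclideanSpace ℝ (Fin (d + 1))) :
    dirNorm q (z + w) ≤ dirNorm q z + dirNorm q w := by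
  have hq' : 1 ≤ ENNReal.ofReal q := by simpa using hq
  have hm : ∀ z : EuclideanSpace ℝ (Fin (d + 1)), MemLp (profile z) (ENNReal.ofReal q) :=
    fun z => memLp_inner_gradKernel normalVec_mem_halfSpace z hq'
  have he : ∀ z : EuclideanSpace ℝ (Fin (d + 1)),
      dirNorm q z = (eLpNorm (profile z) (ENNReal.ofReal q) volume).toReal :=
    fun z => (toReal_eLpNorm_ofReal hq (hm z)).symm
  have hadd : profile (z + w) = profile z + profile w := by
    ext t
    simp [profile, inner_add_right]
  rw [he, he, he, hadd, ← ENNReal.toReal_add (hm z).2.ne (hm w).2.ne]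
  exact ENNReal.toReal_mono (ENNReal.add_ne_top.2 ⟨(hm z).2.ne, (hm w).2.ne⟩)
    (eLpNorm_add_le (hm z).1 (hm w).1 hq')

/-- Every slope `γ ≥ 0` is attained by an upward unit vector. -/
lemma exists_unit_slope (γ : NNReal) : ∃ z : EuclideanSpace ℝ (Fin (k + 1 + 1)),
    ‖z‖ = 1 ∧ 0 < z (Fin.last (k + 1)) ∧ ‖horiz z‖ / z (Fin.last (k + 1)) = γ := by
  set w : EuclideanSpace ℝ (Fin (k + 1 + 1)) :=
    normalVec (k + 1) + bdryPoint (EuclideanSpace.single 0 (γ : ℝ)) with hw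
  have hw1 : w (Fin.last (k + 1)) = 1 := by simp [hw, normalVec_last, bdryPoint_last]
  have hw2 : horiz w = EuclideanSpace.single 0 (γ : ℝ) := by
    ext i
    simp only [hw, horiz, PiLp.add_apply, bdryPoint_castSucc]
    simp [normalVec, Fin.castSucc_ne_last]
  have hw0 : w ≠ 0 := by
    intro h
    rw [h] at hw1
    simp at hw1
  have hn : 0 < ‖w‖ := norm_pos_iff.2 hw0
  have hh : horiz (‖w‖⁻¹ • w) = ‖w‖⁻¹ • horiz w := by
    ext i
    simp [horiz]
  refine ⟨‖w‖⁻¹ • w, ?_, ?_, ?_⟩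
  · rw [norm_smul, norm_inv, norm_norm, inv_mul_cancel₀ hn.ne']
  · simp only [PiLp.smul_apply, hw1, smul_eq_mul, mul_one]
    positivity
  · rw [hh, hw2, norm_smul, norm_inv, norm_norm]
    simp only [PiLp.smul_apply, hw1, smul_eq_mul, mul_one]
    rw [mul_comm, mul_div_assoc, div_self (by positivity), mul_one]
    simp

lemma bddAbove_functional (hk : 0 < k) (hpq : p.HolderConjugate q) :
    BddAbove (Set.range fun γ : NNReal => functional (k + 1 + 1) p γ) := by
  have hωpos := sphereArea_pos hk
  obtain ⟨M, -, hM⟩ := dirNorm_le_mul_norm (d := k + 1) hpq.symm.lt.le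
  refine ⟨M / sphereArea k ^ ((p - 1) / p), ?_⟩
  rintro _ ⟨γ, rfl⟩
  obtain ⟨z, hz1, hz, hγ⟩ := exists_unit_slope (k := k) γ
  have h := hM z
  rw [dirNorm_eq_functional hk hpq hz, hz1, one_mul, mul_one, hγ] at h
  rwa [le_div_iff₀' (by positivity)]

/-- Unit vectors with vanishing last component correspond to `γ = ∞`; there the bound follows by
approximation, since `dirNorm` is a continuous seminorm. -/
lemma iSup_dirNorm_eq_iSup_functional (hk : 0 < k) (hpq : p.HolderConjugate q) :
    ⨆ z : Metric.sphere (0 : EuclideanSpace ℝ (Fin (k + 1 + 1))) 1, dirNorm q z.1 =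
      sphereArea k ^ ((p - 1) / p) * ⨆ γ : NNReal, functional (k + 1 + 1) p γ := by
  have hωpos := sphereArea_pos hk
  have hq : 1 ≤ q := hpq.symm.lt.le
  have hbdd := bddAbove_functional hk hpq
  have : Nonempty (Metric.sphere (0 : EuclideanSpace ℝ (Fin (k + 1 + 1))) 1) :=
    ⟨⟨normalVec (k + 1), by simp [norm_normalVec]⟩⟩
  set B := sphereArea k ^ ((p - 1) / p) * ⨆ γ : NNReal, functional (k + 1 + 1) p γ with hB
  refine le_antisymm (ciSup_le fun z => ?_) ?_
  · have hup : ∀ z : EuclideanSpace ℝ (Fin (k + 1 + 1)), 0 < z (Fin.last (k + 1)) →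
        dirNorm q z ≤ B * ‖z‖ := fun z hz => by
      rw [dirNorm_eq_functional hk hpq hz, hB, mul_assoc, mul_comm ‖z‖]
      gcongr
      exact le_ciSup hbdd ⟨‖horiz z‖ / z (Fin.last (k + 1)), by positivity⟩
    have hnn : ∀ z : EuclideanSpace ℝ (Fin (k + 1 + 1)), 0 ≤ z (Fin.last (k + 1)) →
        ‖z‖ = 1 → dirNorm q z ≤ B := fun z hz hz1 => by
      obtain ⟨M, hM0, hM⟩ := dirNorm_le_mul_norm (d := k + 1) hq
      have hε : ∀ ε : ℝ, 0 < ε → dirNorm q z ≤ B * ‖z + ε • normalVec (k + 1)‖ + M * ε := by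
        intro ε hε
        have h1 := dirNorm_add_le hq (z + ε • normalVec (k + 1)) (-(ε • normalVec (k + 1)))
        rw [add_neg_cancel_right, dirNorm_neg] at h1
        have h2 := hM (ε • normalVec (k + 1))
        rw [norm_smul, norm_normalVec, mul_one, Real.norm_of_nonneg hε.le] at h2
        have h3 := hup (z + ε • normalVec (k + 1)) (by
          simp only [PiLp.add_apply, PiLp.smul_apply, normalVec_last, smul_eq_mul, mul_one]
          linarith)
        linarith
      have hlim : Tendsto (fun ε : ℝ => B * ‖z + ε • normalVec (k + 1)‖ + M * ε) (𝓝[>] 0)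
          (𝓝 (B * ‖z + (0 : ℝ) • normalVec (k + 1)‖ + M * 0)) := by
        have : Continuous fun ε : ℝ => B * ‖z + ε • normalVec (k + 1)‖ + M * ε := by fun_prop
        exact (this.tendsto 0).mono_left nhdsWithin_le_nhds
      have := ge_of_tendsto hlim (eventually_nhdsWithin_of_forall fun ε hε' => hε ε hε')
      simpa [hz1] using this
    have hz1 : ‖z.1‖ = 1 := norm_eq_of_mem_sphere z
    rcases le_total 0 (z.1 (Fin.last (k + 1))) with h | h
    · exact hnn z.1 h hz1
    · rw [← dirNorm_neg]
      exact hnn (-z.1) (by simpa using h) (by rwa [norm_neg])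
  · rw [hB, ← le_div_iff₀' (by positivity)]
    refine ciSup_le fun γ => ?_
    obtain ⟨z, hz1, hz, hγ⟩ := exists_unit_slope (k := k) γ
    have h := le_ciSup (bddAbove_dirNorm (d := k + 1) hq) ⟨z, by simpa using hz1⟩
    rw [le_div_iff₀' (by positivity)]
    rw [dirNorm_eq_functional hk hpq hz, hz1, one_mul, hγ] at h
    exact h

end Formula

end HalfSpaceGradient

open HalfSpaceGradient in
theorem proposition1 (d n : ℕ) (hn : n = d + 1) (h2 : 2 ≤ n) :
    ∃ C : ℝ → ℝ,
      -- the sharp coefficient in the gradient estimate, `1 ≤ p < ∞`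
      (∀ p : ℝ, 1 ≤ p → ∀ x ∈ HalfSpaceGradient.halfSpace d,
        IsLeast (HalfSpaceGradient.gradientCoeffs p x)
          (C p * (x (Fin.last d)) ^ ((1 - (n : ℝ) - p) / p))) ∧
      C 1 = 2 * ((n : ℝ) - 1) / HalfSpaceGradient.sphereArea n ∧
      (3 ≤ n → ∀ p : ℝ, 1 < p →
        BddAbove (Set.range fun γ : NNReal => HalfSpaceGradient.functional n p γ) ∧
        C p = 2 * HalfSpaceGradient.sphereArea (n - 2) ^ ((p - 1) / p) /
            HalfSpaceGradient.sphereArea n *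
          ⨆ γ : NNReal, HalfSpaceGradient.functional n p γ) ∧
      C 2 = Real.sqrt ((n : ℝ) * ((n : ℝ) - 1) / (2 ^ n * HalfSpaceGradient.sphereArea n)) ∧
      -- for `p = 1` and `p = 2` the same coefficient is sharp for the normal derivative
      (∀ p : ℝ, p = 1 ∨ p = 2 → ∀ x ∈ HalfSpaceGradient.halfSpace d,
        IsLeast (HalfSpaceGradient.normalCoeffs p x)
          (C p * (x (Fin.last d)) ^ ((1 - (n : ℝ) - p) / p))) := by
  subst hn
  have hd : 1 ≤ d := by omega
  set C : ℝ → ℝ := fun p => if p = 1 then 2 / sphereArea (d + 1) * d else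
    2 / sphereArea (d + 1) * ⨆ z : Metric.sphere (0 : EuclideanSpace ℝ (Fin (d + 1))) 1,
      dirNorm (p / (p - 1)) z.1 with hC
  have hC1 : C 1 = 2 / sphereArea (d + 1) * d := if_pos rfl
  have hCp : ∀ p : ℝ, 1 < p → C p = 2 / sphereArea (d + 1) *
      ⨆ z : Metric.sphere (0 : EuclideanSpace ℝ (Fin (d + 1))) 1, dirNorm (p / (p - 1)) z.1 :=
    fun p hp => if_neg hp.ne'
  have hconj : ∀ p : ℝ, 1 < p → p.HolderConjugate (p / (p - 1)) :=
    fun p hp => Real.HolderConjugate.conjExponent hp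
  have htwo : (2 : ℝ).HolderConjugate 2 := by
    have := hconj 2 one_lt_two
    norm_num at this
    exact this
  have hC2 : C 2 = 2 / sphereArea (d + 1) * dirNorm 2 (normalVec d) := by
    rw [hCp 2 one_lt_two, ← iSup_dirNorm_two hd]
    norm_num
  have hexp : (1 - ((d + 1 : ℕ) : ℝ) - 1) / 1 = -((d + 1 : ℕ) : ℝ) := by ring
  have hone : ∀ x ∈ halfSpace d, C 1 * x (Fin.last d) ^ ((1 - ((d + 1 : ℕ) : ℝ) - 1) / 1) =
      2 / sphereArea (d + 1) * d * x (Fin.last d) ^ (-((d + 1 : ℕ) : ℝ)) := fun x _ => by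
    rw [hC1, hexp]
  refine ⟨C, fun p hp x hx => ?_, ?_, fun h3 p hp => ?_, ?_, ?_⟩
  · rcases hp.eq_or_lt with rfl | hp
    · rw [hone x hx]
      obtain ⟨h1, h2⟩ := mem_gradientCoeffs_one_and_mem_lowerBounds hd hx
      exact ⟨h1, fun C hC => h2 (gradientCoeffs_subset_normalCoeffs le_rfl hx hC)⟩
    · rw [hCp p hp]
      exact isLeast_gradientCoeffs (hconj p hp) hx
  · rw [hC1]
    push_cast
    ring
  · obtain ⟨k, rfl⟩ : ∃ k, d = k + 1 := ⟨d - 1, by omega⟩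
    have hk : 0 < k := by omega
    refine ⟨bddAbove_functional hk (hconj p hp), ?_⟩
    rw [hCp p hp, iSup_dirNorm_eq_iSup_functional hk (hconj p hp),
      show k + 1 + 1 - 2 = k by omega]
    ring
  · rw [hC2, sharp_two_eq hd]
  · rintro p (rfl | rfl) x hx
    · rw [hone x hx]
      obtain ⟨h1, h2⟩ := mem_gradientCoeffs_one_and_mem_lowerBounds hd hx
      exact ⟨gradientCoeffs_subset_normalCoeffs le_rfl hx h1, h2⟩
    · rw [hC2]
      exact isLeast_normalCoeffs htwo hx
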